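/- **Principle of nil causality.** Let $n\ge 2$, $m\ge 0$, and consider on $\mathbb R^n$ the stochastic system $$d\mathbf x=\mathbf F(\mathbf x,s)\,ds+\mathbf B(\mathbf x,s)\,d\mathbf w ,\qquad(\ast)$$ where $\mathbf w$ is an $m$-dimensional standard Wiener process, $\mathbf F=(F_1,\dots,F_n)$ is continuously differentiable and $\mathbf B=(b_{ik})$ is an $n\times m$ matrix of twice continuously differentiable functions of $(\mathbf x,s)$. Solutions are understood in the weak sense (martingale problem). Suppose that $\mathbf x$ solves $(\ast)$ on a time interval $[t_0,t_1]$ and that $\mathbf x(s)$ has a probability density $\rho(\cdot,s)$ which is compactly supported (uniformly in $s\in[t_0,t_1]$) and twice continuously differentiable in $(\mathbf x,s)$. Write $\mathbf x_{\rm o}=(x_2,\dots,x_n)$, $\rho_{\rm o}=\int_{\mathbb R}\rho\,dx_1$ for the joint density of $\mathbf x_{\rm o}$, and $$H_{\rm o}(s)=-\int_{\mathbb R^{n-1}}\rho_{\rm o}\log\rho_{\rm o}\,d\mathbf x_{\rm o}.$$ Let $t_0<t<t_1$. The *modified system* on an interval $[t,t_2]$, $t_2>t$, is obtained by removing the first equation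 of $(\ast)$ and freezing $x_1$ as a parameter. Let $r(a;\cdot,s)$ be the density at time $s$ of the modified system with parameter $x_1=a$ started at time $t$ from the density $\rho_{\rm o}(\cdot,t)$, and let $q(\cdot,s)$ be the joint density of $(x_1(t),\tilde{\mathbf x}(s))$, where $\tilde{\mathbf x}$ follows the modified system with parameter $x_1(t)$ started from $\tilde{\mathbf x}(t)=\mathbf x_{\rm o}(t)$ (so $q(\cdot,t)=\rho(\cdot,t)$); these densities, too, are assumed to exist, to be compactly supported uniformly in $s\in[t,t_2]$ and to be twice continuously differentiable in space and time. The entropy of $\mathbf x_{\rm o}$ with the effect of $x_1$ excluded is $$H_{\rm o\setminus 1}(s)=-E\big[\log r(x_1(t);\tilde{\mathbf x}(s),s)\big]=-\int_{\mathbb R^n} q(x_1,\mathbf y,s)\,\log r(x_1;\mathbf y,s)\,dx_1\,d\mathbf y ,$$ and the information flow from $x_1$ to $(x_2,\dots,x_n)$ at time $t$ is $$T_{1\to{\rm o}}=\frac{dH_{\rm o}}{ds}\Big|_{s=t}-\frac{dH_{\rm o\setminus1}}{ds}\Big|_{s=t^+}.$$ If $F_2,\dots,F_n$ and the rows $2,\dots,n$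 of $\mathbf B$ do not depend on $x_1$, then both entropies are given by convergent integrals for $s$ near $t$ ($s\ge t$ for $H_{\rm o\setminus 1}$), both derivatives exist, and $$T_{1\to{\rm o}}=0 .$$ -/

import Mathlib

open MeasureTheory ProbabilityTheory Set Filter Topology

universe u

noncomputable section

/-- The partial derivative `∂φ/∂xᵢ` on `ℝᵏ`. -/
def partialD {k : ℕ} (i : Fin k) (φ : (Fin k → ℝ) → ℝ) (x : Fin k → ℝ) : ℝ :=
  fderiv ℝ φ x (Pi.single i 1)

/-- The generator at time `s` of the stochastic system `dx = F(x,s) ds + B(x,s) dw` on `ℝᵏ`,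
`w` an `m`-dimensional standard Wiener process:
`L_s φ = ∑ᵢ Fᵢ ∂ᵢφ + ½ ∑ᵢ ∑ⱼ gᵢⱼ ∂ᵢ∂ⱼφ` with `gᵢⱼ = ∑ₗ bᵢₗ bⱼₗ`. -/
def generator {k m : ℕ} (F : ℝ → (Fin k → ℝ) → (Fin k → ℝ))
    (B : ℝ → (Fin k → ℝ) → Matrix (Fin k) (Fin m) ℝ)
    (s : ℝ) (φ : (Fin k → ℝ) → ℝ) (x : Fin k → ℝ) : ℝ :=
  (∑ i, F s x i * partialD i φ x) +
    (1 / 2) * ∑ i, ∑ j, (∑ l, B s x i l * B s x j l) * partialD i (partialD j φ) x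

/-- `X` is a (weak) solution on the time interval `[s₀, s₁]` of the stochastic system
`dx = F(x,s) ds + B(x,s) dw`, in the sense of the martingale problem: it is a continuous process,
adapted to some filtration, and `φ(X_s) - ∫_{s₀}^s (L_τ φ)(X_τ) dτ` is a martingale for every
smooth compactly supported `φ`. -/
def IsSolution {k m : ℕ} {Ω : Type u} [MeasurableSpace Ω] (P : Measure Ω)
    (F : ℝ → (Fin k → ℝ) → (Fin k → ℝ))
    (B : ℝ → (Fin k → ℝ) → Matrix (Fin k) (Fin m) ℝ)
    (s₀ s₁ : ℝ) (X : ℝ → Ω → (Fin k → ℝ)) : Prop :=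
  (∀ o, ContinuousOn (fun s => X s o) (Icc s₀ s₁)) ∧
  ∃ 𝓕 : Filtration (Icc s₀ s₁) (inferInstance : MeasurableSpace Ω),
    (∀ s : Icc s₀ s₁, Measurable[𝓕 s] (X s)) ∧
    ∀ φ : (Fin k → ℝ) → ℝ, ContDiff ℝ (⊤ : ℕ∞) φ → HasCompactSupport φ →
      Martingale
        (fun (s : Icc s₀ s₁) (o : Ω) =>
          φ (X s o) - ∫ τ in s₀..(s : ℝ), generator F B τ φ (X τ o)) 𝓕 P

/-- `p s` is, for every `s ∈ [s₀, s₁]`, the probability density function of the state at time `s`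
of a solution on `[s₀, s₁]` of the stochastic system with drift `F` and noise amplitude `B`; and
this density is compactly supported (uniformly in `s ∈ [s₀, s₁]`) and twice continuously
differentiable in time and space. -/
def IsCompactPdf {k m : ℕ} (F : ℝ → (Fin k → ℝ) → (Fin k → ℝ))
    (B : ℝ → (Fin k → ℝ) → Matrix (Fin k) (Fin m) ℝ)
    (s₀ s₁ : ℝ) (p : ℝ → (Fin k → ℝ) → ℝ) : Prop :=
  (∃ (Ω : Type u) (_ : MeasurableSpace Ω) (P : Measure Ω) (_ : IsProbabilityMeasure P)
      (X : ℝ → Ω → (Fin k → ℝ)),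
    IsSolution P F B s₀ s₁ X ∧
    ∀ s ∈ Icc s₀ s₁, P.map (X s) = volume.withDensity (fun x => ENNReal.ofReal (p s x))) ∧
  (∀ s ∈ Icc s₀ s₁, ∀ x, 0 ≤ p s x) ∧
  (∃ K : Set (Fin k → ℝ), IsCompact K ∧ ∀ s ∈ Icc s₀ s₁, ∀ x, x ∉ K → p s x = 0) ∧
  ContDiffOn ℝ 2 (fun z : ℝ × (Fin k → ℝ) => p z.1 z.2) (Icc s₀ s₁ ×ˢ univ)

/-- The joint density of all components but the first one: the first variable (which has
index `0`) of `f` is integrated out. -/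
def marginalOthers {d : ℕ} (f : (Fin (d + 1) → ℝ) → ℝ) (y : Fin d → ℝ) : ℝ :=
  ∫ a : ℝ, f (Matrix.vecCons a y)

/-- The entropy of the components other than the first one at time `s`, where `ρ` is the density
of the whole state: `H(s) = - ∫ ρ_others log ρ_others`. -/
def entropyOthers {d : ℕ} (ρ : ℝ → (Fin (d + 1) → ℝ) → ℝ) (s : ℝ) : ℝ :=
  - ∫ y : Fin d → ℝ, marginalOthers (ρ s) y * Real.log (marginalOthers (ρ s) y)

/-- Drift of the system in which the first component is frozen (its equation becomes
`dx₁ = 0`), seen as a system for the whole state. -/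
def frozenDrift {d : ℕ} (F : ℝ → (Fin (d + 1) → ℝ) → (Fin (d + 1) → ℝ))
    (s : ℝ) (x : Fin (d + 1) → ℝ) : Fin (d + 1) → ℝ :=
  Matrix.vecCons 0 (fun i : Fin d => F s x i.succ)

/-- Noise amplitude of the system in which the first component is frozen, seen as a system for
the whole state. -/
def frozenNoise {d m : ℕ} (B : ℝ → (Fin (d + 1) → ℝ) → Matrix (Fin (d + 1)) (Fin m) ℝ)
    (s : ℝ) (x : Fin (d + 1) → ℝ) : Matrix (Fin (d + 1)) (Fin m) ℝ :=
  Matrix.of (Matrix.vecCons (0 : Fin m → ℝ) (fun i : Fin d => B s x i.succ))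

/-- Drift of the system for the components other than the first one, obtained by removing the
first equation and keeping the first component as a parameter `a`. -/
def parameterDrift {d : ℕ} (F : ℝ → (Fin (d + 1) → ℝ) → (Fin (d + 1) → ℝ)) (a : ℝ)
    (s : ℝ) (y : Fin d → ℝ) : Fin d → ℝ :=
  fun i => F s (Matrix.vecCons a y) i.succ

/-- Noise amplitude of the system for the components other than the first one, with the first
component as a parameter `a`. -/
def parameterNoise {d m : ℕ} (B : ℝ → (Fin (d + 1) → ℝ) → Matrix (Fin (d + 1)) (Fin m) ℝ)
    (a : ℝ) (s : ℝ) (y : Fin d → ℝ) : Matrix (Fin d) (Fin m) ℝ :=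
  Matrix.of (fun i l => B s (Matrix.vecCons a y) i.succ l)

/-- The evolution on `[t, t₂]` of the system modified by freezing the first component at time `t`,
given the density `ρt` of the state at time `t`:
* `q s` is the density at time `s` of the state `(x₁(t), x̃(s))` whose first component stays
  what it was at time `t` and whose other components follow the modified system, starting from
  `x(t)` itself (so that `q t = ρt`);
* `r a s` is the density at time `s` of the modified system with parameter `x₁ = a`, equal
  at time `t` to the joint density of the components of `x(t)` other than the first one. -/
def IsFrozenEvolution {d m : ℕ} (F : ℝ → (Fin (d + 1) → ℝ) → (Fin (d + 1) → ℝ))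
    (B : ℝ → (Fin (d + 1) → ℝ) → Matrix (Fin (d + 1)) (Fin m) ℝ)
    (ρt : (Fin (d + 1) → ℝ) → ℝ) (t t₂ : ℝ)
    (q : ℝ → (Fin (d + 1) → ℝ) → ℝ) (r : ℝ → ℝ → (Fin d → ℝ) → ℝ) : Prop :=
  (IsCompactPdf.{u} (frozenDrift F) (frozenNoise B) t t₂ q ∧ q t = ρt) ∧
  ∀ a : ℝ, IsCompactPdf.{u} (parameterDrift F a) (parameterNoise B a) t t₂ (r a) ∧
    r a t = marginalOthers ρt

/-- The entropy at time `s` of the components other than the first one, with the effect of the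
first component excluded: `- E[log r(x₁(t); x̃(s), s)]`, the expectation being over the state
`(x₁(t), x̃(s))` of the modified system. -/
def entropyExcluded {d : ℕ} (q : ℝ → (Fin (d + 1) → ℝ) → ℝ) (r : ℝ → ℝ → (Fin d → ℝ) → ℝ)
    (s : ℝ) : ℝ :=
  - ∫ x : Fin (d + 1) → ℝ, q s x * Real.log (r (x 0) s (Fin.tail x))

/-- `T` is the information flow at time `t` from the first component to the others:
`T = dH_others/dt - dH_excluded/dt`, where both entropies are finite near `t` and both derivatives
exist (the second one from the right, since the modified system starts at time `t`). -/
def IsInformationFlow {d : ℕ} (ρ q : ℝ → (Fin (d + 1) → ℝ) → ℝ) (r : ℝ → ℝ → (Fin d → ℝ) → ℝ)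
    (t T : ℝ) : Prop :=
  (∀ᶠ s in 𝓝 t, Integrable fun y : Fin d → ℝ =>
    marginalOthers (ρ s) y * Real.log (marginalOthers (ρ s) y)) ∧
  (∀ᶠ s in 𝓝[≥] t, Integrable fun x : Fin (d + 1) → ℝ =>
    q s x * Real.log (r (x 0) s (Fin.tail x))) ∧
  ∃ h h' : ℝ, HasDerivAt (entropyOthers ρ) h t ∧
    HasDerivWithinAt (entropyExcluded q r) h' (Ici t) t ∧ T = h - h'

end

/-!
Since `x₁` does not enter the other equations, the marginal of `ρ`, the marginal of `q` and every
`r a` solve the Fokker-Planck equation of one and the same reduced system, with the same value at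
time `t`. Compactly supported solutions of this equation are unique: `L (u²) ≥ 2 u L u` for the
generator `L`, so `d/ds ∫ u² = 2 ∫ u L* u ≤ ∫ u² L* 1 ≤ C ∫ u²`. Hence both entropies agree to the
right of `t`, and they have the same derivative once `∫ v log v` is differentiable in time. This
holds because `(∂v/∂s)² ≤ N v` for a nonnegative `C²` function `v`, while `√v log v` is bounded.
-/

section PartialDerivative

variable {k : ℕ} {f g : (Fin k → ℝ) → ℝ}

theorem contDiff_partialD {m n : WithTop ℕ∞} (hf : ContDiff ℝ n f) (hmn : m + 1 ≤ n)
    (i : Fin k) : ContDiff ℝ m (partialD i f) :=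
  (hf.fderiv_right hmn).clm_apply contDiff_const

theorem contDiff_partialD_uncurry {m n : WithTop ℕ∞} {f : ℝ × (Fin k → ℝ) → ℝ}
    (hf : ContDiff ℝ n f) (hmn : m + 1 ≤ n) (i : Fin k) :
    ContDiff ℝ m fun z : ℝ × (Fin k → ℝ) => partialD i (fun x => f (z.1, x)) z.2 := by
  have hpartial : (fun z : ℝ × (Fin k → ℝ) => partialD i (fun x => f (z.1, x)) z.2) =
      fun z => fderiv ℝ f z (0, Pi.single i 1) := by
    funext z
    have hn : n ≠ 0 := by rintro rfl; simp at hmn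
    have hfz : HasFDerivAt f (fderiv ℝ f z) (z.1, z.2) := (hf.differentiable hn z).hasFDerivAt
    exact congrArg (· (Pi.single i 1)) (hfz.comp z.2 (hasFDerivAt_prodMk_right z.1 z.2)).fderiv
  rw [hpartial]
  exact (hf.fderiv_right hmn).clm_apply contDiff_const

theorem tsupport_partialD_subset (i : Fin k) : tsupport (partialD i f) ⊆ tsupport f :=
  tsupport_fderiv_apply_subset ℝ _

theorem hasCompactSupport_partialD (hf : HasCompactSupport f) (i : Fin k) :
    HasCompactSupport (partialD i f) :=
  hf.fderiv_apply ℝ _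

theorem partialD_eventuallyEq {x : Fin k → ℝ} (h : f =ᶠ[𝓝 x] g) (i : Fin k) :
    partialD i f =ᶠ[𝓝 x] partialD i g :=
  h.fderiv.fun_comp (· (Pi.single i 1))

theorem partialD_const (i : Fin k) (c : ℝ) :
    partialD i (fun _ : Fin k → ℝ => c) = fun _ => 0 := by
  funext x
  simp [partialD]

theorem partialD_add (hf : Differentiable ℝ f) (hg : Differentiable ℝ g) (i : Fin k) :
    partialD i (fun x => f x + g x) = fun x => partialD i f x + partialD i g x := by
  funext x
  simp only [partialD, fderiv_fun_add (hf x) (hg x), add_apply]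

theorem partialD_sub (hf : Differentiable ℝ f) (hg : Differentiable ℝ g) (i : Fin k) :
    partialD i (fun x => f x - g x) = fun x => partialD i f x - partialD i g x := by
  funext x
  simp only [partialD, fderiv_fun_sub (hf x) (hg x), sub_apply]

theorem partialD_mul (hf : Differentiable ℝ f) (hg : Differentiable ℝ g) (i : Fin k) :
    partialD i (fun x => f x * g x) = fun x => f x * partialD i g x + g x * partialD i f x := by
  funext x
  simp only [partialD, fderiv_fun_mul (hf x) (hg x), add_apply, smul_apply, smul_eq_mul]

theorem integrable_partialD (hf : ContDiff ℝ 1 f) (hc : HasCompactSupport f) (i : Fin k) :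
    Integrable (partialD i f) :=
  (contDiff_partialD (m := 0) hf (by simp) i).continuous.integrable_of_hasCompactSupport
    (hasCompactSupport_partialD hc i)

theorem integral_partialD_eq_zero (hf : ContDiff ℝ 1 f) (hc : HasCompactSupport f) (i : Fin k) :
    ∫ x, partialD i f x = 0 := by
  have hparts := integral_mul_fderiv_eq_neg_fderiv_mul_of_integrable (μ := volume)
    (f := fun _ : Fin k → ℝ => (1 : ℝ)) (g := f) (v := Pi.single i 1) (by simp)
    (by simpa only [one_mul] using! integrable_partialD hf hc i)
    (by simpa using hf.continuous.integrable_of_hasCompactSupport hc)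
    (fun _ _ => differentiableAt_const _) (fun x _ => hf.differentiable one_ne_zero x)
  simpa [partialD] using hparts

end PartialDerivative

section Generator

variable {k m : ℕ} {F : ℝ → (Fin k → ℝ) → (Fin k → ℝ)}
  {B : ℝ → (Fin k → ℝ) → Matrix (Fin k) (Fin m) ℝ} {s : ℝ} {φ ψ u v : (Fin k → ℝ) → ℝ}

/-- The entry `gᵢⱼ` of the diffusion matrix `g = B Bᵀ`, whose halves are the second order
coefficients of the generator. -/
noncomputable def diffusion (B : ℝ → (Fin k → ℝ) → Matrix (Fin k) (Fin m) ℝ)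
    (s : ℝ) (x : Fin k → ℝ) (i j : Fin k) : ℝ :=
  ∑ l, B s x i l * B s x j l

/-- The formal adjoint `L* u = -∑ᵢ ∂ᵢ(Fᵢ u) + ½ ∑ᵢ ∑ⱼ ∂ⱼ∂ᵢ(gᵢⱼ u)` of the generator, which is the
right-hand side of the Fokker-Planck equation. -/
noncomputable def generatorAdjoint (F : ℝ → (Fin k → ℝ) → (Fin k → ℝ))
    (B : ℝ → (Fin k → ℝ) → Matrix (Fin k) (Fin m) ℝ)
    (s : ℝ) (u : (Fin k → ℝ) → ℝ) (x : Fin k → ℝ) : ℝ :=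
  -(∑ i, partialD i (fun y => F s y i * u y) x) +
    (1 / 2) * ∑ i, ∑ j, partialD j (partialD i fun y => diffusion B s y i j * u y) x

theorem generator_eq_drift_add_diffusion :
    generator F B s φ = fun x => (∑ i, F s x i * partialD i φ x) +
      (1 / 2) * ∑ i, ∑ j, diffusion B s x i j * partialD i (partialD j φ) x :=
  rfl

theorem contDiff_diffusion {E : Type*} [NormedAddCommGroup E] [NormedSpace ℝ E]
    {n : WithTop ℕ∞} {σ : E → ℝ} {ξ : E → Fin k → ℝ}
    (hB : ∀ i l, ContDiff ℝ n fun z => B (σ z) (ξ z) i l) (i j : Fin k) :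
    ContDiff ℝ n fun z => diffusion B (σ z) (ξ z) i j := by
  exact ContDiff.sum fun l _ => (hB i l).mul (hB j l)

theorem sum_diffusion_mul_mul_nonneg (B : ℝ → (Fin k → ℝ) → Matrix (Fin k) (Fin m) ℝ)
    (s : ℝ) (x ξ : Fin k → ℝ) : 0 ≤ ∑ i, ∑ j, diffusion B s x i j * (ξ i * ξ j) := by
  have hsq : ∑ i, ∑ j, diffusion B s x i j * (ξ i * ξ j) = ∑ l, (∑ i, B s x i l * ξ i) ^ 2 := by
    simp_rw [sq, Fintype.sum_mul_sum, diffusion, Finset.sum_mul]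
    rw [Finset.sum_comm_cycle]
    exact Fintype.sum_congr _ _ fun l => Fintype.sum_congr _ _ fun i =>
      Fintype.sum_congr _ _ fun j => by ring
  rw [hsq]
  positivity

theorem continuous_generator
    (hF : ∀ i, Continuous fun z : ℝ × (Fin k → ℝ) => F z.1 z.2 i)
    (hB : ∀ i l, Continuous fun z : ℝ × (Fin k → ℝ) => B z.1 z.2 i l) (hφ : ContDiff ℝ 2 φ) :
    Continuous fun z : ℝ × (Fin k → ℝ) => generator F B z.1 φ z.2 := by
  have hφ' (i) : ContDiff ℝ 1 (partialD i φ) := contDiff_partialD hφ (by norm_num) i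
  have hφ'' (i j) : ContDiff ℝ 0 (partialD i (partialD j φ)) :=
    contDiff_partialD (hφ' j) (by simp) i
  exact (continuous_finsetSum _ fun i _ => (hF i).mul ((hφ' i).continuous.comp continuous_snd)).add
    (continuous_const.mul (continuous_finsetSum _ fun i _ => continuous_finsetSum _ fun j _ =>
      (continuous_finsetSum _ fun l _ => (hB i l).mul (hB j l)).mul
        ((hφ'' i j).continuous.comp continuous_snd)))

theorem generator_eq_zero_of_notMem_tsupport {x : Fin k → ℝ} (hx : x ∉ tsupport φ) :
    generator F B s φ x = 0 := by
  have hφ' (i) : partialD i φ x = 0 :=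
    image_eq_zero_of_notMem_tsupport fun h => hx (tsupport_partialD_subset i h)
  have hφ'' (i j) : partialD i (partialD j φ) x = 0 := image_eq_zero_of_notMem_tsupport fun h =>
    hx (tsupport_partialD_subset j (tsupport_partialD_subset i h))
  simp [generator, hφ', hφ'']

theorem hasCompactSupport_generator (hφ : HasCompactSupport φ) :
    HasCompactSupport (generator F B s φ) :=
  .intro hφ.isCompact fun _ => generator_eq_zero_of_notMem_tsupport

theorem exists_abs_generator_le (hF : ∀ i, Continuous fun z : ℝ × (Fin k → ℝ) => F z.1 z.2 i)
    (hB : ∀ i l, Continuous fun z : ℝ × (Fin k → ℝ) => B z.1 z.2 i l)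
    (hφ : ContDiff ℝ 2 φ) (hφc : HasCompactSupport φ) {J : Set ℝ} (hJ : IsCompact J) :
    ∃ C, ∀ τ ∈ J, ∀ x, |generator F B τ φ x| ≤ C := by
  obtain ⟨C, hC⟩ := (hJ.prod hφc.isCompact).exists_bound_of_continuousOn
    (continuous_generator hF hB hφ).continuousOn
  refine ⟨max C 0, fun τ hτ x => ?_⟩
  by_cases hx : x ∈ tsupport φ
  · exact (hC (τ, x) ⟨hτ, hx⟩).trans (le_max_left _ _)
  · simp [generator_eq_zero_of_notMem_tsupport hx]

theorem generator_congr {x : Fin k → ℝ} (h : φ =ᶠ[𝓝 x] ψ) :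
    generator F B s φ x = generator F B s ψ x := by
  have hφ' (i) := (partialD_eventuallyEq h i).eq_of_nhds
  have hφ'' (i j) := (partialD_eventuallyEq (partialD_eventuallyEq h j) i).eq_of_nhds
  simp only [generator, hφ', hφ'']

theorem generator_mul_self (hφ : ContDiff ℝ 2 φ) (x : Fin k → ℝ) :
    generator F B s (fun y => φ y * φ y) x = 2 * (φ x * generator F B s φ x) +
      ∑ i, ∑ j, diffusion B s x i j * (partialD i φ x * partialD j φ x) := by
  have hd : Differentiable ℝ φ := hφ.differentiable two_ne_zero
  have hd' (i) : Differentiable ℝ (partialD i φ) :=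
    (contDiff_partialD hφ (by norm_num) i).differentiable one_ne_zero
  have hfirst (i) : partialD i (fun y => φ y * φ y) =
      fun y => φ y * partialD i φ y + φ y * partialD i φ y := partialD_mul hd hd i
  have hsecond (i j) : partialD i (partialD j fun y => φ y * φ y) x =
      2 * (φ x * partialD i (partialD j φ) x) + 2 * (partialD i φ x * partialD j φ x) := by
    rw [hfirst, partialD_add (hd.fun_mul (hd' j)) (hd.fun_mul (hd' j)), partialD_mul hd (hd' j)]
    ring
  have hdrift : ∑ i, F s x i * partialD i (fun y => φ y * φ y) x =
      2 * (φ x * ∑ i, F s x i * partialD i φ x) := by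
    simp only [hfirst, Finset.mul_sum]
    exact Fintype.sum_congr _ _ fun i => by ring
  have hnoise : ∑ i, ∑ j, diffusion B s x i j * partialD i (partialD j fun y => φ y * φ y) x =
      2 * (φ x * ∑ i, ∑ j, diffusion B s x i j * partialD i (partialD j φ) x) +
        2 * ∑ i, ∑ j, diffusion B s x i j * (partialD i φ x * partialD j φ x) := by
    simp only [hsecond, Finset.mul_sum, ← Finset.sum_add_distrib]
    exact Fintype.sum_congr _ _ fun i => Fintype.sum_congr _ _ fun j => by ring
  simp only [generator_eq_drift_add_diffusion, hdrift, hnoise]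
  ring

theorem two_mul_generator_le (hφ : ContDiff ℝ 2 φ) (x : Fin k → ℝ) :
    2 * (φ x * generator F B s φ x) ≤ generator F B s (fun y => φ y * φ y) x := by
  rw [generator_mul_self hφ]
  exact le_add_of_nonneg_right (sum_diffusion_mul_mul_nonneg B s x _)

theorem continuous_generatorAdjoint
    (hF : ∀ i, ContDiff ℝ 1 fun z : ℝ × (Fin k → ℝ) => F z.1 z.2 i)
    (hB : ∀ i l, ContDiff ℝ 2 fun z : ℝ × (Fin k → ℝ) => B z.1 z.2 i l) (hu : ContDiff ℝ 2 u) :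
    Continuous fun z : ℝ × (Fin k → ℝ) => generatorAdjoint F B z.1 u z.2 := by
  have hu' : ContDiff ℝ 2 fun z : ℝ × (Fin k → ℝ) => u z.2 := hu.comp contDiff_snd
  have hdrift (i) : ContDiff ℝ 0 fun z : ℝ × (Fin k → ℝ) =>
      partialD i (fun y => F z.1 y i * u y) z.2 :=
    contDiff_partialD_uncurry ((hF i).mul (hu'.of_le one_le_two)) (by simp) i
  have hnoise' (i j) : ContDiff ℝ 1 fun z : ℝ × (Fin k → ℝ) =>
      partialD i (fun y => diffusion B z.1 y i j * u y) z.2 :=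
    contDiff_partialD_uncurry ((contDiff_diffusion hB i j).mul hu') (by norm_num) i
  have hnoise (i j) : ContDiff ℝ 0 fun z : ℝ × (Fin k → ℝ) =>
      partialD j (partialD i fun y => diffusion B z.1 y i j * u y) z.2 :=
    contDiff_partialD_uncurry (hnoise' i j) (by simp) j
  exact (continuous_finsetSum _ fun i _ => (hdrift i).continuous).neg.add (continuous_const.mul
    (continuous_finsetSum _ fun i _ => continuous_finsetSum _ fun j _ => (hnoise i j).continuous))

theorem generatorAdjoint_sub (hF : ∀ i, ContDiff ℝ 1 fun x => F s x i)
    (hB : ∀ i l, ContDiff ℝ 2 fun x => B s x i l) (hu : ContDiff ℝ 2 u) (hv : ContDiff ℝ 2 v) :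
    generatorAdjoint F B s (fun x => u x - v x) =
      fun x => generatorAdjoint F B s u x - generatorAdjoint F B s v x := by
  have hdrift (i) {w : (Fin k → ℝ) → ℝ} (hw : ContDiff ℝ 2 w) :
      Differentiable ℝ fun y => F s y i * w y :=
    ((hF i).mul (hw.of_le one_le_two)).differentiable one_ne_zero
  have hnoise (i j) {w : (Fin k → ℝ) → ℝ} (hw : ContDiff ℝ 2 w) :
      ContDiff ℝ 2 fun y => diffusion B s y i j * w y :=
    (contDiff_diffusion hB i j).mul hw
  have hnoise' (i j) {w : (Fin k → ℝ) → ℝ} (hw : ContDiff ℝ 2 w) :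
      Differentiable ℝ (partialD i fun y => diffusion B s y i j * w y) :=
    (contDiff_partialD (hnoise i j hw) (by norm_num) i).differentiable one_ne_zero
  funext x
  simp only [generatorAdjoint, mul_sub, partialD_sub (hdrift _ hu) (hdrift _ hv),
    partialD_sub ((hnoise _ _ hu).differentiable two_ne_zero)
      ((hnoise _ _ hv).differentiable two_ne_zero),
    partialD_sub (hnoise' _ _ hu) (hnoise' _ _ hv), Finset.sum_sub_distrib]
  ring

theorem generator_mul_sub_mul_generatorAdjoint (hF : ∀ i, ContDiff ℝ 1 fun x => F s x i)
    (hB : ∀ i l, ContDiff ℝ 2 fun x => B s x i l) (hφ : ContDiff ℝ 2 φ) (hu : ContDiff ℝ 2 u)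
    (x : Fin k → ℝ) :
    generator F B s φ x * u x - φ x * generatorAdjoint F B s u x =
      (∑ i, partialD i (fun y => F s y i * u y * φ y) x) + (1 / 2) * ∑ i, ∑ j,
        (partialD i (fun y => diffusion B s y i j * u y * partialD j φ y) x -
          partialD j (fun y => φ y * partialD i (fun z => diffusion B s z i j * u z) y) x) := by
  have hdφ : Differentiable ℝ φ := hφ.differentiable two_ne_zero
  have hdφ' (j) : Differentiable ℝ (partialD j φ) :=
    (contDiff_partialD hφ (by norm_num) j).differentiable one_ne_zero
  have hdF (i) : Differentiable ℝ fun y => F s y i * u y :=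
    ((hF i).mul (hu.of_le one_le_two)).differentiable one_ne_zero
  have hgu (i j) : ContDiff ℝ 2 fun y => diffusion B s y i j * u y :=
    (contDiff_diffusion hB i j).mul hu
  have hdgu' (i j) : Differentiable ℝ (partialD i fun y => diffusion B s y i j * u y) :=
    (contDiff_partialD (hgu i j) (by norm_num) i).differentiable one_ne_zero
  have hdrift (i) : partialD i (fun y => F s y i * u y * φ y) x =
      F s x i * partialD i φ x * u x + φ x * partialD i (fun y => F s y i * u y) x := by
    rw [partialD_mul (hdF i) hdφ]
    ring
  have hnoise (i j) : partialD i (fun y => diffusion B s y i j * u y * partialD j φ y) x -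
      partialD j (fun y => φ y * partialD i (fun z => diffusion B s z i j * u z) y) x =
      diffusion B s x i j * partialD i (partialD j φ) x * u x -
        φ x * partialD j (partialD i fun y => diffusion B s y i j * u y) x := by
    rw [partialD_mul ((hgu i j).differentiable two_ne_zero) (hdφ' j),
      partialD_mul hdφ (hdgu' i j)]
    ring
  simp only [hdrift, hnoise, generator_eq_drift_add_diffusion, generatorAdjoint,
    Finset.sum_add_distrib, Finset.sum_sub_distrib, ← Finset.mul_sum, ← Finset.sum_mul]
  ring

theorem integrable_generator_mul (hF : ∀ i, Continuous fun x => F s x i)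
    (hB : ∀ i l, Continuous fun x => B s x i l) (hφ : ContDiff ℝ 2 φ)
    (hφc : HasCompactSupport φ) (hu : Continuous u) :
    Integrable fun x => generator F B s φ x * u x := by
  have hcont : Continuous (generator F B s φ) :=
    (continuous_generator (F := fun _ => F s) (B := fun _ => B s)
      (fun i => (hF i).comp continuous_snd) (fun i l => (hB i l).comp continuous_snd) hφ).comp
      (Continuous.prodMk_right s)
  exact (hcont.mul hu).integrable_of_hasCompactSupport (hasCompactSupport_generator hφc).mul_right

theorem integrable_mul_generatorAdjoint (hF : ∀ i, ContDiff ℝ 1 fun x => F s x i)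
    (hB : ∀ i l, ContDiff ℝ 2 fun x => B s x i l) (hφ : Continuous φ)
    (hφc : HasCompactSupport φ) (hu : ContDiff ℝ 2 u) :
    Integrable fun x => φ x * generatorAdjoint F B s u x := by
  have hcont : Continuous (generatorAdjoint F B s u) :=
    (continuous_generatorAdjoint (F := fun _ => F s) (B := fun _ => B s)
      (fun i => (hF i).comp contDiff_snd) (fun i l => (hB i l).comp contDiff_snd) hu).comp
      (Continuous.prodMk_right s)
  exact (hφ.mul hcont).integrable_of_hasCompactSupport hφc.mul_right

theorem integral_generator_mul (hF : ∀ i, ContDiff ℝ 1 fun x => F s x i)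
    (hB : ∀ i l, ContDiff ℝ 2 fun x => B s x i l) (hφ : ContDiff ℝ 2 φ)
    (hφc : HasCompactSupport φ) (hu : ContDiff ℝ 2 u) :
    ∫ x, generator F B s φ x * u x = ∫ x, φ x * generatorAdjoint F B s u x := by
  have hgu (i j) : ContDiff ℝ 2 fun y => diffusion B s y i j * u y :=
    (contDiff_diffusion hB i j).mul hu
  have hdrift (i) : ContDiff ℝ 1 fun y => F s y i * u y * φ y :=
    ((hF i).mul (hu.of_le one_le_two)).mul (hφ.of_le one_le_two)
  have hnoise (i j) : ContDiff ℝ 1 fun y => diffusion B s y i j * u y * partialD j φ y :=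
    ((hgu i j).of_le one_le_two).mul (contDiff_partialD hφ (by norm_num) j)
  have hnoise' (i j) :
      ContDiff ℝ 1 fun y => φ y * partialD i (fun z => diffusion B s z i j * u z) y :=
    (hφ.of_le one_le_two).mul (contDiff_partialD (hgu i j) (by norm_num) i)
  have hdriftc (i) : HasCompactSupport fun y => F s y i * u y * φ y := hφc.mul_left
  have hnoisec (i j) : HasCompactSupport fun y => diffusion B s y i j * u y * partialD j φ y :=
    (hasCompactSupport_partialD hφc j).mul_left
  have hnoisec' (i j) :
      HasCompactSupport fun y => φ y * partialD i (fun z => diffusion B s z i j * u z) y :=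
    hφc.mul_right
  have hdrifti (i) := integrable_partialD (hdrift i) (hdriftc i) i
  have hnoisei (i j) := integrable_partialD (hnoise i j) (hnoisec i j) i
  have hnoisei' (i j) := integrable_partialD (hnoise' i j) (hnoisec' i j) j
  have hdriftInt : Integrable fun x => ∑ i, partialD i (fun y => F s y i * u y * φ y) x :=
    integrable_finsetSum _ fun i _ => hdrifti i
  have hnoisedi (i j) : Integrable fun x =>
      partialD i (fun y => diffusion B s y i j * u y * partialD j φ y) x -
        partialD j (fun y => φ y * partialD i (fun z => diffusion B s z i j * u z) y) x :=
    (hnoisei i j).sub (hnoisei' i j)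
  have hnoiseInt (i) := integrable_finsetSum Finset.univ fun j _ => hnoisedi i j
  rw [← sub_eq_zero, ← integral_sub
    (integrable_generator_mul (fun i => (hF i).continuous) (fun i l => (hB i l).continuous) hφ hφc
      hu.continuous) (integrable_mul_generatorAdjoint hF hB hφ.continuous hφc hu)]
  simp only [generator_mul_sub_mul_generatorAdjoint hF hB hφ hu]
  rw [integral_add hdriftInt ((integrable_finsetSum _ fun i _ => hnoiseInt i).const_mul _),
    integral_const_mul, integral_finsetSum _ fun i _ => hdrifti i,
    integral_finsetSum _ fun i _ => hnoiseInt i]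
  simp only [integral_finsetSum _ fun j _ => hnoisedi _ j,
    integral_sub (hnoisei _ _) (hnoisei' _ _), integral_partialD_eq_zero (hdrift _) (hdriftc _),
    integral_partialD_eq_zero (hnoise _ _) (hnoisec _ _),
    integral_partialD_eq_zero (hnoise' _ _) (hnoisec' _ _), sub_zero, Finset.sum_const_zero,
    mul_zero, add_zero]

end Generator

section ContDiffFamily

variable {E : Type*} [NormedAddCommGroup E] [NormedSpace ℝ E] {u v : ℝ → E → ℝ} {I J : Set ℝ}
  {s : ℝ} {m n : WithTop ℕ∞}

/-- The time derivative `∂u/∂s` of a time dependent function `u`. -/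
noncomputable def timeDeriv (u : ℝ → E → ℝ) (s : ℝ) (x : E) : ℝ :=
  deriv (fun τ => u τ x) s

/-- The functions `u s`, `s ∈ I`, vanish outside a common compact set, and `(s, x) ↦ u s x` is
`Cⁿ` on `I × E`. Densities and their differences are handled as such families. -/
structure IsContDiffFamily (n : WithTop ℕ∞) (I : Set ℝ) (u : ℝ → E → ℝ) : Prop where
  contDiffOn : ContDiffOn ℝ n (fun z : ℝ × E => u z.1 z.2) (I ×ˢ univ)
  exists_isCompact : ∃ K : Set E, IsCompact K ∧ ∀ s ∈ I, ∀ x ∉ K, u s x = 0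

namespace IsContDiffFamily

theorem mono (hu : IsContDiffFamily n I u) (hJ : J ⊆ I) : IsContDiffFamily n J u where
  contDiffOn := hu.contDiffOn.mono (prod_mono_left hJ)
  exists_isCompact := hu.exists_isCompact.imp fun _ hK => hK.imp_right fun h s hs => h s (hJ hs)

theorem of_le (hu : IsContDiffFamily n I u) (hmn : m ≤ n) : IsContDiffFamily m I u :=
  ⟨hu.contDiffOn.of_le hmn, hu.exists_isCompact⟩

theorem sub (hu : IsContDiffFamily n I u) (hv : IsContDiffFamily n I v) :
    IsContDiffFamily n I fun s x => u s x - v s x where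
  contDiffOn := hu.contDiffOn.sub hv.contDiffOn
  exists_isCompact := by
    obtain ⟨K, hK, hKu⟩ := hu.exists_isCompact
    obtain ⟨L, hL, hLv⟩ := hv.exists_isCompact
    refine ⟨K ∪ L, hK.union hL, fun s hs x hx => ?_⟩
    rw [hKu s hs x fun h => hx (.inl h), hLv s hs x fun h => hx (.inr h), sub_zero]

theorem mul (hu : IsContDiffFamily n I u)
    (hv : ContDiffOn ℝ n (fun z : ℝ × E => v z.1 z.2) (I ×ˢ univ)) :
    IsContDiffFamily n I fun s x => u s x * v s x where
  contDiffOn := hu.contDiffOn.mul hv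
  exists_isCompact := hu.exists_isCompact.imp fun _ hK =>
    hK.imp_right fun h s hs x hx => by rw [h s hs x hx, zero_mul]

theorem contDiff (hu : IsContDiffFamily n I u) (hs : s ∈ I) : ContDiff ℝ n (u s) :=
  contDiffOn_univ.1 <| hu.contDiffOn.comp (f := fun x => (s, x))
    (contDiff_const.prodMk contDiff_id).contDiffOn fun _ _ => ⟨hs, mem_univ _⟩

theorem hasCompactSupport (hu : IsContDiffFamily n I u) (hs : s ∈ I) :
    HasCompactSupport (u s) :=
  have ⟨_, hK, hKu⟩ := hu.exists_isCompact
  .intro hK (hKu s hs)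

theorem eventually_abs_le (hu : IsContDiffFamily n I u) (hI : I ∈ 𝓝 s) :
    ∃ C, ∀ᶠ τ in 𝓝 s, ∀ x, |u τ x| ≤ C := by
  obtain ⟨K, hK, hKu⟩ := hu.exists_isCompact
  obtain ⟨J, hJ, hJI, hJc⟩ := local_compact_nhds hI
  obtain ⟨C, hC⟩ := (hJc.prod hK).exists_bound_of_continuousOn
    (hu.contDiffOn.continuousOn.mono (prod_mono hJI (subset_univ K)))
  refine ⟨max C 0, Filter.eventually_of_mem hJ fun τ hτ x => ?_⟩
  by_cases hx : x ∈ K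
  · exact (hC (τ, x) ⟨hτ, hx⟩).trans (le_max_left _ _)
  · simp [hKu τ (hJI hτ) x hx]

theorem hasDerivAt_fderiv (hu : IsContDiffFamily n I u) (hn : n ≠ 0) (hI : IsOpen I)
    (hs : s ∈ I) (x : E) :
    HasDerivAt (fun τ => u τ x) (fderiv ℝ (fun z : ℝ × E => u z.1 z.2) (s, x) (1, 0)) s := by
  have hfderiv : HasFDerivAt (fun z : ℝ × E => u z.1 z.2)
      (fderiv ℝ (fun z : ℝ × E => u z.1 z.2) (s, x)) (s, x) :=
    ((hu.contDiffOn.contDiffAt ((hI.prod isOpen_univ).mem_nhds ⟨hs, mem_univ _⟩)).differentiableAt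
      hn).hasFDerivAt
  exact hfderiv.comp_hasDerivAt (f := fun τ => (τ, x)) s
    ((hasDerivAt_id s).prodMk (hasDerivAt_const s x))

theorem hasDerivAt (hu : IsContDiffFamily n I u) (hn : n ≠ 0) (hI : IsOpen I) (hs : s ∈ I)
    (x : E) : HasDerivAt (fun τ => u τ x) (timeDeriv u s x) s :=
  (hu.hasDerivAt_fderiv hn hI hs x).differentiableAt.hasDerivAt

protected theorem timeDeriv (hu : IsContDiffFamily n I u) (hmn : m + 1 ≤ n) (hI : IsOpen I) :
    IsContDiffFamily m I (timeDeriv u) where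
  contDiffOn := by
    have hn : n ≠ 0 := by rintro rfl; simp at hmn
    exact ((hu.contDiffOn.fderiv_of_isOpen (hI.prod isOpen_univ) hmn).clm_apply
      contDiffOn_const).congr fun z hz => (hu.hasDerivAt_fderiv hn hI hz.1 z.2).deriv
  exists_isCompact := by
    obtain ⟨K, hK, hKu⟩ := hu.exists_isCompact
    refine ⟨K, hK, fun s hs x hx => ?_⟩
    have hzero : (fun τ => u τ x) =ᶠ[𝓝 s] fun _ => 0 :=
      Filter.eventually_of_mem (hI.mem_nhds hs) fun τ hτ => hKu τ hτ x hx
    exact hzero.deriv_eq.trans (deriv_const s 0)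

end IsContDiffFamily

theorem hasDerivAt_integral_of_eq_zero_of_notMem {α : Type*} [MeasurableSpace α] {μ : Measure α}
    {f f' : ℝ → α → ℝ} {K : Set α} (hK : MeasurableSet K) (hμK : μ K ≠ ⊤) {C : ℝ}
    (hf : ∀ᶠ τ in 𝓝 s, Integrable (f τ) μ) (hf' : AEStronglyMeasurable (f' s) μ)
    (hbound : ∀ᶠ τ in 𝓝 s, ∀ x, |f' τ x| ≤ C) (hzero : ∀ᶠ τ in 𝓝 s, ∀ x ∉ K, f' τ x = 0)
    (hderiv : ∀ᶠ τ in 𝓝 s, ∀ x, HasDerivAt (fun σ => f σ x) (f' τ x) τ) :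
    HasDerivAt (fun τ => ∫ x, f τ x ∂μ) (∫ x, f' s x ∂μ) s := by
  have hindicator : ∀ᶠ τ in 𝓝 s, ∀ x, ‖f' τ x‖ ≤ K.indicator (fun _ => C) x := by
    filter_upwards [hbound, hzero] with τ hle heq x
    by_cases hx : x ∈ K
    · simpa [hx] using hle x
    · simp [hx, heq x hx]
  exact (hasDerivAt_integral_of_dominated_loc_of_deriv_le (hindicator.and hderiv)
    (hf.mono fun _ h => h.aestronglyMeasurable) hf.self_of_nhds hf'
    (.of_forall fun x _ hτ => hτ.1 x)
    ((integrable_indicator_iff hK).2 (integrableOn_const hμK))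
    (.of_forall fun x _ hτ => hτ.2 x)).2

namespace IsContDiffFamily

variable [MeasurableSpace E] [BorelSpace E] {μ : Measure E} [IsFiniteMeasureOnCompacts μ]

theorem integrable (hu : IsContDiffFamily n I u) (hs : s ∈ I) : Integrable (u s) μ :=
  (hu.contDiff hs).continuous.integrable_of_hasCompactSupport (hu.hasCompactSupport hs)

theorem hasDerivAt_integral (hu : IsContDiffFamily 1 I u) (hI : IsOpen I) (hs : s ∈ I) :
    HasDerivAt (fun τ => ∫ x, u τ x ∂μ) (∫ x, timeDeriv u s x ∂μ) s := by
  have hu' : IsContDiffFamily 0 I (timeDeriv u) := hu.timeDeriv (by simp) hI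
  obtain ⟨C, hC⟩ := hu'.eventually_abs_le (hI.mem_nhds hs)
  obtain ⟨K, hK, hKu'⟩ := hu'.exists_isCompact
  have hIs : ∀ᶠ τ in 𝓝 s, τ ∈ I := hI.mem_nhds hs
  exact hasDerivAt_integral_of_eq_zero_of_notMem hK.measurableSet hK.measure_ne_top
    (hIs.mono fun _ => hu.integrable) (hu'.integrable hs).aestronglyMeasurable hC
    (hIs.mono hKu') (hIs.mono fun _ hτ => hu.hasDerivAt one_ne_zero hI hτ)

end IsContDiffFamily

end ContDiffFamily

section MartingaleProblem

theorem integrable_uncurry_of_continuousOn {Ω : Type*} [MeasurableSpace Ω] {P : Measure Ω}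
    [IsFiniteMeasure P] {Y : ℝ → Ω → ℝ} {a b C : ℝ} (hab : a ≤ b)
    (hcont : ∀ o, ContinuousOn (fun τ => Y τ o) (Icc a b))
    (hmeas : ∀ τ ∈ Icc a b, Measurable (Y τ)) (hC : ∀ τ ∈ Icc a b, ∀ o, |Y τ o| ≤ C) :
    Integrable (Function.uncurry Y) ((volume.restrict (uIoc a b)).prod P) := by
  rw [uIoc_of_le hab]
  have hproj (τ) : (projIcc a b hab τ : ℝ) ∈ Icc a b := (projIcc a b hab τ).2
  have hYmeas : Measurable (Function.uncurry fun τ o => Y (projIcc a b hab τ) o) :=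
    measurable_uncurry_of_continuous_of_measurable
      (fun o => (hcont o).comp_continuous (continuous_subtype_val.comp continuous_projIcc) hproj)
      fun τ => hmeas _ (hproj τ)
  have hYint : Integrable (Function.uncurry fun τ o => Y (projIcc a b hab τ) o)
      ((volume.restrict (Ioc a b)).prod P) :=
    .of_bound hYmeas.aestronglyMeasurable C (.of_forall fun z => hC _ (hproj _) _)
  have hrestrict : (volume.restrict (Ioc a b)).prod P =
      (volume.prod P).restrict (Ioc a b ×ˢ univ) := by
    rw [← Measure.prod_restrict, Measure.restrict_univ]
  rw [hrestrict] at hYint ⊢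
  refine IntegrableOn.congr_fun hYint (fun z hz => ?_) (measurableSet_Ioc.prod .univ)
  have hz1 : z.1 ∈ Icc a b := Ioc_subset_Icc_self hz.1
  simp only [Function.uncurry, projIcc_of_mem hab hz1]

theorem integral_comp_eq_integral_mul {Ω E : Type*} [MeasurableSpace Ω] [MeasurableSpace E]
    {P : Measure Ω} {μ : Measure E} {X : Ω → E} (hX : Measurable X) {p : E → ℝ}
    (hpm : Measurable p) (hp : ∀ x, 0 ≤ p x)
    (hlaw : P.map X = μ.withDensity fun x => ENNReal.ofReal (p x)) {g : E → ℝ}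
    (hg : Measurable g) : ∫ o, g (X o) ∂P = ∫ x, g x * p x ∂μ := by
  rw [← integral_map hX.aemeasurable hg.aestronglyMeasurable, hlaw,
    integral_withDensity_eq_integral_toReal_smul hpm.ennreal_ofReal (by simp)]
  simp only [ENNReal.toReal_ofReal (hp _), smul_eq_mul, mul_comm]

variable {k m : ℕ} {F : ℝ → (Fin k → ℝ) → (Fin k → ℝ)}
  {B : ℝ → (Fin k → ℝ) → Matrix (Fin k) (Fin m) ℝ} {a b s : ℝ} {u : ℝ → (Fin k → ℝ) → ℝ}

/-- `u` solves on `[a, b]` the Fokker-Planck equation of `dx = F(x,s) ds + B(x,s) dw` in the weak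
sense, that is, integrated in time and tested against smooth compactly supported functions. -/
def IsWeakFokkerPlanckSolution (F : ℝ → (Fin k → ℝ) → (Fin k → ℝ))
    (B : ℝ → (Fin k → ℝ) → Matrix (Fin k) (Fin m) ℝ) (a b : ℝ)
    (u : ℝ → (Fin k → ℝ) → ℝ) : Prop :=
  ∀ φ : (Fin k → ℝ) → ℝ, ContDiff ℝ (⊤ : ℕ∞) φ → HasCompactSupport φ → ∀ s ∈ Icc a b,
    ∫ x, φ x * u s x =
      (∫ x, φ x * u a x) + ∫ τ in a..s, ∫ x, generator F B τ φ x * u τ x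

theorem IsSolution.measurable {Ω : Type u} [MeasurableSpace Ω] {P : Measure Ω}
    {X : ℝ → Ω → (Fin k → ℝ)} (hX : IsSolution P F B a b X) (hs : s ∈ Icc a b) :
    Measurable (X s) :=
  have ⟨_, 𝓕, hadapted, _⟩ := hX
  (hadapted ⟨s, hs⟩).mono (𝓕.le _) le_rfl

theorem IsSolution.integral_eq_add {Ω : Type u} [MeasurableSpace Ω] {P : Measure Ω}
    [IsProbabilityMeasure P] {X : ℝ → Ω → (Fin k → ℝ)} (hX : IsSolution P F B a b X)
    (hF : ∀ i, Continuous fun z : ℝ × (Fin k → ℝ) => F z.1 z.2 i)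
    (hB : ∀ i l, Continuous fun z : ℝ × (Fin k → ℝ) => B z.1 z.2 i l) {φ : (Fin k → ℝ) → ℝ}
    (hφ : ContDiff ℝ (⊤ : ℕ∞) φ) (hφc : HasCompactSupport φ) (hs : s ∈ Icc a b) :
    ∫ o, φ (X s o) ∂P =
      (∫ o, φ (X a o) ∂P) + ∫ τ in a..s, ∫ o, generator F B τ φ (X τ o) ∂P := by
  obtain ⟨hpath, 𝓕, -, hmart⟩ := id hX
  have hsub : Icc a s ⊆ Icc a b := Icc_subset_Icc_right hs.2
  have hφ2 : ContDiff ℝ 2 φ := hφ.of_le (by norm_cast)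
  have hgen := continuous_generator hF hB hφ2
  obtain ⟨C, hC⟩ := exists_abs_generator_le hF hB hφ2 hφc (isCompact_Icc (a := a) (b := s))
  have hint : Integrable (Function.uncurry fun τ o => generator F B τ φ (X τ o))
      ((volume.restrict (uIoc a s)).prod P) :=
    integrable_uncurry_of_continuousOn hs.1
      (fun o => hgen.comp_continuousOn (continuousOn_id.prodMk ((hpath o).mono hsub)))
      (fun τ hτ => (hgen.comp (Continuous.prodMk_right τ)).measurable.comp
        (hX.measurable (hsub hτ))) fun τ hτ o => hC τ hτ _
  have hφint {τ} (hτ : τ ∈ Icc a b) : Integrable (fun o => φ (X τ o)) P := by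
    obtain ⟨D, hD⟩ := hφ.continuous.bounded_above_of_compact_support hφc
    exact .of_bound (hφ.continuous.measurable.comp (hX.measurable hτ)).aestronglyMeasurable D
      (.of_forall fun o => hD _)
  have hexp := (hmart φ hφ hφc).setIntegral_eq (i := ⟨a, hs.1.trans hs.2 |> left_mem_Icc.2⟩)
    (j := ⟨s, hs⟩) (Subtype.mk_le_mk.2 hs.1) MeasurableSet.univ
  have hgint : Integrable (fun o => ∫ τ in a..s, generator F B τ φ (X τ o)) P := by
    simpa only [uIoc_of_le hs.1, ← intervalIntegral.integral_of_le hs.1] using!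
      hint.integral_prod_right
  simp only [setIntegral_univ, intervalIntegral.integral_same, sub_zero] at hexp
  rw [hexp, intervalIntegral_integral_swap hint, integral_sub (hφint hs) hgint, sub_add_cancel]

variable {p : ℝ → (Fin k → ℝ) → ℝ}

theorem IsCompactPdf.isContDiffFamily (hp : IsCompactPdf.{u} F B a b p) :
    IsContDiffFamily 2 (Icc a b) p :=
  ⟨hp.2.2.2, hp.2.2.1⟩

theorem IsCompactPdf.isWeakFokkerPlanckSolution (hp : IsCompactPdf.{u} F B a b p)
    (hF : ∀ i, Continuous fun z : ℝ × (Fin k → ℝ) => F z.1 z.2 i)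
    (hB : ∀ i l, Continuous fun z : ℝ × (Fin k → ℝ) => B z.1 z.2 i l) :
    IsWeakFokkerPlanckSolution F B a b p := by
  intro φ hφ hφc s hs
  have hfam := hp.isContDiffFamily
  obtain ⟨⟨Ω, _, P, _, X, hX, hlaw⟩, hp0, -⟩ := hp
  have hexp {τ} (hτ : τ ∈ Icc a b) {g : (Fin k → ℝ) → ℝ} (hg : Continuous g) :
      ∫ o, g (X τ o) ∂P = ∫ x, g x * p τ x :=
    integral_comp_eq_integral_mul (hX.measurable hτ) (hfam.contDiff hτ).continuous.measurable
      (hp0 τ hτ) (hlaw τ hτ) hg.measurable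
  have hgen : Continuous fun z : ℝ × (Fin k → ℝ) => generator F B z.1 φ z.2 :=
    continuous_generator hF hB (hφ.of_le (by norm_cast))
  rw [← hexp hs hφ.continuous, ← hexp ⟨le_rfl, hs.1.trans hs.2⟩ hφ.continuous,
    hX.integral_eq_add hF hB hφ hφc hs]
  congr 1
  refine intervalIntegral.integral_congr fun τ hτ => ?_
  rw [uIcc_of_le hs.1] at hτ
  exact hexp ⟨hτ.1, hτ.2.trans hs.2⟩ (hgen.comp (Continuous.prodMk_right τ))

end MartingaleProblem

section FokkerPlanck

variable {k m : ℕ} {F : ℝ → (Fin k → ℝ) → (Fin k → ℝ)}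
  {B : ℝ → (Fin k → ℝ) → Matrix (Fin k) (Fin m) ℝ} {a b a' b' s : ℝ}
  {u v : ℝ → (Fin k → ℝ) → ℝ}

theorem IsWeakFokkerPlanckSolution.integral_mul_eq_add (hu : IsWeakFokkerPlanckSolution F B a b u)
    {K : Set (Fin k → ℝ)} (hK : IsCompact K) (hKu : ∀ τ ∈ Icc a b, ∀ x ∉ K, u τ x = 0)
    {φ : (Fin k → ℝ) → ℝ} (hφ : ContDiff ℝ (⊤ : ℕ∞) φ) (hs : s ∈ Icc a b) :
    ∫ x, φ x * u s x =
      (∫ x, φ x * u a x) + ∫ τ in a..s, ∫ x, generator F B τ φ x * u τ x := by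
  obtain ⟨R, hR, hKR⟩ := hK.isBounded.subset_ball_lt 0 (0 : Fin k → ℝ)
  let χ : ContDiffBump (0 : Fin k → ℝ) := ⟨R, R + 1, hR, lt_add_one R⟩
  have hχφ {x} (hx : x ∈ K) : (fun y => χ y * φ y) =ᶠ[𝓝 x] φ := by
    filter_upwards [Metric.isOpen_ball.mem_nhds (hKR hx)] with y hy
    rw [χ.one_of_mem_closedBall (Metric.ball_subset_closedBall hy), one_mul]
  have hcongr {f g : (Fin k → ℝ) → ℝ} (hfg : ∀ x ∈ K, f x = g x) {τ} (hτ : τ ∈ Icc a b) :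
      ∫ x, f x * u τ x = ∫ x, g x * u τ x := by
    congr 1 with x
    by_cases hx : x ∈ K
    · rw [hfg x hx]
    · rw [hKu τ hτ x hx, mul_zero, mul_zero]
  have hcut := hu (fun y => χ y * φ y) (χ.contDiff.mul hφ) χ.hasCompactSupport.mul_right s hs
  rw [hcongr (fun x hx => (hχφ hx).eq_of_nhds) hs,
    hcongr (fun x hx => (hχφ hx).eq_of_nhds) ⟨le_rfl, hs.1.trans hs.2⟩] at hcut
  rw [hcut]
  congr 1
  refine intervalIntegral.integral_congr fun τ hτ => ?_
  rw [uIcc_of_le hs.1] at hτ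
  exact hcongr (fun x hx => generator_congr (hχφ hx)) ⟨hτ.1, hτ.2.trans hs.2⟩

theorem IsContDiffFamily.continuousOn_integral_mul {I : Set ℝ} {n : WithTop ℕ∞}
    (hu : IsContDiffFamily n I u) {g : ℝ → (Fin k → ℝ) → ℝ}
    (hg : Continuous fun z : ℝ × (Fin k → ℝ) => g z.1 z.2) :
    ContinuousOn (fun τ => ∫ x, g τ x * u τ x) I := by
  obtain ⟨K, hK, hKu⟩ := hu.exists_isCompact
  exact continuousOn_integral_of_compact_support hK
    (hg.continuousOn.mul hu.contDiffOn.continuousOn)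
    fun τ x hτ hx => by rw [hKu τ hτ x hx, mul_zero]

theorem IsWeakFokkerPlanckSolution.hasDerivAt_integral_mul
    (hu : IsWeakFokkerPlanckSolution F B a b u) (huI : IsContDiffFamily 0 (Icc a b) u)
    (hF : ∀ i, Continuous fun z : ℝ × (Fin k → ℝ) => F z.1 z.2 i)
    (hB : ∀ i l, Continuous fun z : ℝ × (Fin k → ℝ) => B z.1 z.2 i l) {φ : (Fin k → ℝ) → ℝ}
    (hφ : ContDiff ℝ (⊤ : ℕ∞) φ) (hφc : HasCompactSupport φ) (hs : s ∈ Ioo a b) :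
    HasDerivAt (fun τ => ∫ x, φ x * u τ x) (∫ x, generator F B s φ x * u s x) s := by
  have hcont : ContinuousOn (fun τ => ∫ x, generator F B τ φ x * u τ x) (Icc a b) :=
    huI.continuousOn_integral_mul (continuous_generator hF hB (hφ.of_le (by norm_cast)))
  have hnhds : Icc a b ∈ 𝓝 s := Icc_mem_nhds hs.1 hs.2
  have hftc : HasDerivAt (fun σ => ∫ τ in a..σ, ∫ x, generator F B τ φ x * u τ x)
      (∫ x, generator F B s φ x * u s x) s := by
    refine intervalIntegral.integral_hasDerivAt_right (hcont.mono ?_).intervalIntegrable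
      ((hcont.mono Ioo_subset_Icc_self).stronglyMeasurableAtFilter isOpen_Ioo s hs)
      (hcont.continuousAt hnhds)
    rw [uIcc_of_le hs.1.le]
    exact Icc_subset_Icc_right hs.2.le
  refine (hftc.const_add (∫ x, φ x * u a x)).congr_of_eventuallyEq ?_
  filter_upwards [hnhds] with τ hτ using hu φ hφ hφc τ hτ

/-- `u` is a classical solution on `(a, b)` of the Fokker-Planck equation `∂u/∂s = L_s^* u` of
`dx = F(x,s) ds + B(x,s) dw`, compactly supported uniformly in time and continuous up to the end
points. -/
structure IsFokkerPlanckSolution (F : ℝ → (Fin k → ℝ) → (Fin k → ℝ))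
    (B : ℝ → (Fin k → ℝ) → Matrix (Fin k) (Fin m) ℝ) (a b : ℝ)
    (u : ℝ → (Fin k → ℝ) → ℝ) : Prop where
  isContDiffFamily_Icc : IsContDiffFamily 0 (Icc a b) u
  isContDiffFamily_Ioo : IsContDiffFamily 2 (Ioo a b) u
  timeDeriv_eq : ∀ s ∈ Ioo a b, timeDeriv u s = generatorAdjoint F B s (u s)

theorem IsWeakFokkerPlanckSolution.isFokkerPlanckSolution
    (hu : IsWeakFokkerPlanckSolution F B a b u) (hIcc : IsContDiffFamily 0 (Icc a b) u)
    (hIoo : IsContDiffFamily 2 (Ioo a b) u)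
    (hF : ∀ i, ContDiff ℝ 1 fun z : ℝ × (Fin k → ℝ) => F z.1 z.2 i)
    (hB : ∀ i l, ContDiff ℝ 2 fun z : ℝ × (Fin k → ℝ) => B z.1 z.2 i l) :
    IsFokkerPlanckSolution F B a b u := by
  refine ⟨hIcc, hIoo, fun s hs => ?_⟩
  have hFs (i) : ContDiff ℝ 1 fun x => F s x i := (hF i).comp (contDiff_prodMk_right s)
  have hBs (i l) : ContDiff ℝ 2 fun x => B s x i l := (hB i l).comp (contDiff_prodMk_right s)
  have hus : ContDiff ℝ 2 (u s) := hIoo.contDiff hs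
  have htime : Continuous (timeDeriv u s) :=
    ((hIoo.timeDeriv (m := 1) (by norm_num) isOpen_Ioo).contDiff hs).continuous
  have hadj : Continuous (generatorAdjoint F B s (u s)) :=
    (continuous_generatorAdjoint hF hB hus).comp (Continuous.prodMk_right s)
  have htest {φ : (Fin k → ℝ) → ℝ} (hφ : ContDiff ℝ (⊤ : ℕ∞) φ) (hφc : HasCompactSupport φ) :
      ∫ x, φ x * timeDeriv u s x = ∫ x, φ x * generatorAdjoint F B s (u s) x := by
    have hφ2 : ContDiff ℝ 2 φ := hφ.of_le (by norm_cast)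
    have hfamily : IsContDiffFamily 1 (Ioo a b) fun τ x => u τ x * φ x :=
      (hIoo.of_le one_le_two).mul (((hφ2.of_le one_le_two).comp contDiff_snd).contDiffOn)
    have hderiv : timeDeriv (fun τ x => u τ x * φ x) s = fun x => φ x * timeDeriv u s x := by
      funext x
      rw [timeDeriv, deriv_mul_const_field, mul_comm, timeDeriv]
    have hweak := hu.hasDerivAt_integral_mul hIcc (fun i => (hF i).continuous)
      (fun i l => (hB i l).continuous) hφ hφc hs
    rw [integral_generator_mul hFs hBs hφ2 hφc hus] at hweak
    simp only [mul_comm (φ _) (u _ _)] at hweak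
    rw [← hderiv]
    exact (hfamily.hasDerivAt_integral isOpen_Ioo hs).unique hweak
  refine (Continuous.ae_eq_iff_eq volume htime hadj).1 ?_
  exact ae_eq_of_integral_contDiff_smul_eq htime.locallyIntegrable hadj.locallyIntegrable
    fun φ hφ hφc => htest hφ hφc

namespace IsFokkerPlanckSolution

theorem mono (hu : IsFokkerPlanckSolution F B a b u) (ha : a ≤ a') (hb : b' ≤ b) :
    IsFokkerPlanckSolution F B a' b' u where
  isContDiffFamily_Icc := hu.isContDiffFamily_Icc.mono (Icc_subset_Icc ha hb)
  isContDiffFamily_Ioo := hu.isContDiffFamily_Ioo.mono (Ioo_subset_Ioo ha hb)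
  timeDeriv_eq s hs := hu.timeDeriv_eq s (Ioo_subset_Ioo ha hb hs)

theorem sub (hu : IsFokkerPlanckSolution F B a b u) (hv : IsFokkerPlanckSolution F B a b v)
    (hF : ∀ s i, ContDiff ℝ 1 fun x => F s x i) (hB : ∀ s i l, ContDiff ℝ 2 fun x => B s x i l) :
    IsFokkerPlanckSolution F B a b fun s x => u s x - v s x where
  isContDiffFamily_Icc := hu.isContDiffFamily_Icc.sub hv.isContDiffFamily_Icc
  isContDiffFamily_Ioo := hu.isContDiffFamily_Ioo.sub hv.isContDiffFamily_Ioo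
  timeDeriv_eq s hs := by
    rw [generatorAdjoint_sub (hF s) (hB s) (hu.isContDiffFamily_Ioo.contDiff hs)
      (hv.isContDiffFamily_Ioo.contDiff hs), ← hu.timeDeriv_eq s hs, ← hv.timeDeriv_eq s hs]
    funext x
    exact ((hu.isContDiffFamily_Ioo.hasDerivAt two_ne_zero isOpen_Ioo hs x).sub
      (hv.isContDiffFamily_Ioo.hasDerivAt two_ne_zero isOpen_Ioo hs x)).deriv

end IsFokkerPlanckSolution

end FokkerPlanck

section Uniqueness

theorem le_mul_exp_of_hasDerivAt_le_mul {f f' : ℝ → ℝ} {a b C s : ℝ}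
    (hf : ContinuousOn f (Icc a b)) (hf' : ∀ τ ∈ Ioo a b, HasDerivAt f (f' τ) τ)
    (hle : ∀ τ ∈ Ioo a b, f' τ ≤ C * f τ) (hs : s ∈ Icc a b) :
    f s ≤ f a * Real.exp (C * (s - a)) := by
  have hexp (τ) : HasDerivAt (fun σ => Real.exp (-(C * σ))) (Real.exp (-(C * τ)) * -C) τ := by
    simpa using (((hasDerivAt_id τ).const_mul C).neg).exp
  have hanti : AntitoneOn (fun τ => f τ * Real.exp (-(C * τ))) (Icc a b) := by
    refine antitoneOn_of_hasDerivWithinAt_nonpos (convex_Icc a b) (hf.mul (by fun_prop))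
      (f' := fun τ => f' τ * Real.exp (-(C * τ)) + f τ * (Real.exp (-(C * τ)) * -C))
      (fun τ hτ => ?_) fun τ hτ => ?_ <;> rw [interior_Icc] at hτ
    · exact ((hf' τ hτ).mul (hexp τ)).hasDerivWithinAt
    · nlinarith [hle τ hτ, Real.exp_pos (-(C * τ))]
  have hmul := hanti (left_mem_Icc.2 (hs.1.trans hs.2)) hs hs.1
  calc f s = f s * Real.exp (-(C * s)) * Real.exp (C * s) := by
        rw [mul_assoc, ← Real.exp_add, neg_add_cancel, Real.exp_zero, mul_one]
    _ ≤ f a * Real.exp (-(C * a)) * Real.exp (C * s) := by gcongr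
    _ = f a * Real.exp (C * (s - a)) := by rw [mul_assoc, ← Real.exp_add]; ring_nf

variable {k m : ℕ} {F : ℝ → (Fin k → ℝ) → (Fin k → ℝ)}
  {B : ℝ → (Fin k → ℝ) → Matrix (Fin k) (Fin m) ℝ} {a b C s : ℝ}
  {u v : ℝ → (Fin k → ℝ) → ℝ} {φ : (Fin k → ℝ) → ℝ}

theorem two_mul_integral_mul_generatorAdjoint_le (hF : ∀ i, ContDiff ℝ 1 fun x => F s x i)
    (hB : ∀ i l, ContDiff ℝ 2 fun x => B s x i l) (hφ : ContDiff ℝ 2 φ)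
    (hφc : HasCompactSupport φ)
    (hC : ∀ x, φ x ≠ 0 → generatorAdjoint F B s (fun _ => 1) x ≤ C) :
    2 * ∫ x, φ x * generatorAdjoint F B s φ x ≤ C * ∫ x, φ x * φ x := by
  have hφφc : HasCompactSupport fun x => φ x * φ x := hφc.mul_right
  have hgen {ψ w : (Fin k → ℝ) → ℝ} (hψ : ContDiff ℝ 2 ψ) (hψc : HasCompactSupport ψ)
      (hw : Continuous w) : Integrable fun x => generator F B s ψ x * w x :=
    integrable_generator_mul (fun i => (hF i).continuous) (fun i l => (hB i l).continuous) hψ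
      hψc hw
  calc 2 * ∫ x, φ x * generatorAdjoint F B s φ x
      = ∫ x, 2 * (generator F B s φ x * φ x) := by
        rw [← integral_generator_mul hF hB hφ hφc hφ, integral_const_mul]
    _ ≤ ∫ x, generator F B s (fun y => φ y * φ y) x * 1 := by
        refine integral_mono ((hgen hφ hφc hφ.continuous).const_mul 2)
          (hgen (hφ.mul hφ) hφφc continuous_const) fun x => ?_
        simpa only [mul_one, mul_comm (φ x)] using two_mul_generator_le hφ x
    _ = ∫ x, φ x * φ x * generatorAdjoint F B s (fun _ => 1) x :=
        integral_generator_mul hF hB (hφ.mul hφ) hφφc contDiff_const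
    _ ≤ ∫ x, C * (φ x * φ x) := by
        refine integral_mono
          (integrable_mul_generatorAdjoint hF hB (hφ.mul hφ).continuous hφφc contDiff_const)
          (((hφ.mul hφ).continuous.integrable_of_hasCompactSupport hφφc).const_mul C)
          fun x => ?_
        by_cases hx : φ x = 0
        · simp [hx]
        · simpa only [mul_comm C] using
            mul_le_mul_of_nonneg_left (hC x hx) (mul_self_nonneg (φ x))
    _ = C * ∫ x, φ x * φ x := integral_const_mul _ _

namespace IsFokkerPlanckSolution

theorem hasDerivAt_integral_mul_self (hu : IsFokkerPlanckSolution F B a b u) (hs : s ∈ Ioo a b) :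
    HasDerivAt (fun τ => ∫ x, u τ x * u τ x)
      (2 * ∫ x, u s x * generatorAdjoint F B s (u s) x) s := by
  have hfamily : IsContDiffFamily 1 (Ioo a b) u := hu.isContDiffFamily_Ioo.of_le one_le_two
  have hderiv : timeDeriv (fun τ x => u τ x * u τ x) s =
      fun x => 2 * (u s x * generatorAdjoint F B s (u s) x) := by
    funext x
    have hux := hfamily.hasDerivAt one_ne_zero isOpen_Ioo hs x
    rw [← hu.timeDeriv_eq s hs, timeDeriv, (hux.fun_mul hux).deriv]
    ring
  rw [← integral_const_mul, ← hderiv]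
  exact (hfamily.mul hfamily.contDiffOn).hasDerivAt_integral isOpen_Ioo hs

theorem eq_zero (hu : IsFokkerPlanckSolution F B a b u)
    (hF : ∀ i, ContDiff ℝ 1 fun z : ℝ × (Fin k → ℝ) => F z.1 z.2 i)
    (hB : ∀ i l, ContDiff ℝ 2 fun z : ℝ × (Fin k → ℝ) => B z.1 z.2 i l) (hua : u a = 0)
    (hs : s ∈ Icc a b) : u s = 0 := by
  obtain ⟨K, hK, hKu⟩ := hu.isContDiffFamily_Icc.exists_isCompact
  obtain ⟨C, hC⟩ := ((isCompact_Icc (a := a) (b := b)).prod hK).exists_bound_of_continuousOn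
    (continuous_generatorAdjoint hF hB (u := fun _ => 1) contDiff_const).continuousOn
  have henergy {τ} (hτ : τ ∈ Ioo a b) :
      2 * ∫ x, u τ x * generatorAdjoint F B τ (u τ) x ≤ C * ∫ x, u τ x * u τ x := by
    refine two_mul_integral_mul_generatorAdjoint_le
      (fun i => (hF i).comp (contDiff_prodMk_right τ))
      (fun i l => (hB i l).comp (contDiff_prodMk_right τ)) (hu.isContDiffFamily_Ioo.contDiff hτ)
      (hu.isContDiffFamily_Ioo.hasCompactSupport hτ) fun x hx => ?_
    have hxK : x ∈ K := by_contra fun h => hx (hKu τ (Ioo_subset_Icc_self hτ) x h)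
    exact (le_abs_self _).trans (hC (τ, x) ⟨Ioo_subset_Icc_self hτ, hxK⟩)
  have hsq := hu.isContDiffFamily_Icc.mul hu.isContDiffFamily_Icc.contDiffOn
  have hcont : ContinuousOn (fun τ => ∫ x, u τ x * u τ x) (Icc a b) := by
    simpa only [one_mul] using hsq.continuousOn_integral_mul (g := fun _ _ => 1) continuous_const
  have hle : ∫ x, u s x * u s x ≤ 0 := by
    simpa [hua] using le_mul_exp_of_hasDerivAt_le_mul hcont
      (fun τ hτ => hu.hasDerivAt_integral_mul_self hτ) (fun τ hτ => henergy hτ) hs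
  have hnonneg (x) : 0 ≤ u s x * u s x := mul_self_nonneg _
  have hae := (integral_eq_zero_iff_of_nonneg hnonneg (hsq.integrable hs)).1
    (hle.antisymm (integral_nonneg hnonneg))
  have hzero := (Continuous.ae_eq_iff_eq volume (hsq.contDiff hs).continuous continuous_zero).1 hae
  exact funext fun x => mul_self_eq_zero.1 (congrFun hzero x)

theorem eqOn (hu : IsFokkerPlanckSolution F B a b u) (hv : IsFokkerPlanckSolution F B a b v)
    (hF : ∀ i, ContDiff ℝ 1 fun z : ℝ × (Fin k → ℝ) => F z.1 z.2 i)
    (hB : ∀ i l, ContDiff ℝ 2 fun z : ℝ × (Fin k → ℝ) => B z.1 z.2 i l) (h : u a = v a) :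
    EqOn u v (Icc a b) := by
  intro s hs
  have hsub : IsFokkerPlanckSolution F B a b fun τ x => u τ x - v τ x :=
    hu.sub hv (fun τ i => (hF i).comp (contDiff_prodMk_right τ))
      fun τ i l => (hB i l).comp (contDiff_prodMk_right τ)
  have hzero := hsub.eq_zero hF hB (funext fun x => sub_eq_zero.2 (congrFun h x)) hs
  exact funext fun x => sub_eq_zero.1 (congrFun hzero x)

end IsFokkerPlanckSolution

end Uniqueness

section Marginal

variable {d m : ℕ}

theorem contDiff_vecCons {n : WithTop ℕ∞} :
    ContDiff ℝ n fun z : ℝ × (Fin d → ℝ) => (Matrix.vecCons z.1 z.2 : Fin (d + 1) → ℝ) := by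
  refine contDiff_pi.2 (Fin.cases ?_ fun j => ?_)
  · simpa using contDiff_fst
  · exact (contDiff_apply ℝ ℝ j).comp contDiff_snd

theorem contDiff_tail {n : WithTop ℕ∞} :
    ContDiff ℝ n fun x : Fin (d + 1) → ℝ => (Fin.tail x : Fin d → ℝ) :=
  contDiff_pi.2 fun i => contDiff_apply ℝ ℝ i.succ

theorem coe_piFinSuccAbove_symm_eq_vecCons :
    ⇑(MeasurableEquiv.piFinSuccAbove (fun _ : Fin (d + 1) => ℝ) 0).symm =
      fun z : ℝ × (Fin d → ℝ) => (Matrix.vecCons z.1 z.2 : Fin (d + 1) → ℝ) := by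
  funext z
  simp [MeasurableEquiv.piFinSuccAbove, Matrix.vecCons, Fin.consEquiv]

theorem measurePreserving_vecCons : MeasurePreserving
    fun z : ℝ × (Fin d → ℝ) => (Matrix.vecCons z.1 z.2 : Fin (d + 1) → ℝ) := by
  rw [← coe_piFinSuccAbove_symm_eq_vecCons]
  exact (volume_preserving_piFinSuccAbove (fun _ : Fin (d + 1) => ℝ) 0).symm

theorem measurableEmbedding_vecCons : MeasurableEmbedding
    fun z : ℝ × (Fin d → ℝ) => (Matrix.vecCons z.1 z.2 : Fin (d + 1) → ℝ) := by
  rw [← coe_piFinSuccAbove_symm_eq_vecCons]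
  exact MeasurableEquiv.measurableEmbedding _

theorem tail_vecCons (a : ℝ) (y : Fin d → ℝ) : Fin.tail (Matrix.vecCons a y) = y :=
  Fin.tail_cons (α := fun _ => ℝ) a y

variable {f : (Fin (d + 1) → ℝ) → ℝ} {g : (Fin d → ℝ) → ℝ}

theorem marginalOthers_nonneg (hf : ∀ x, 0 ≤ f x) (y : Fin d → ℝ) : 0 ≤ marginalOthers f y :=
  integral_nonneg fun _ => hf _

theorem marginalOthers_eq_zero {K : Set (Fin (d + 1) → ℝ)} (hf : ∀ x ∉ K, f x = 0)
    {y : Fin d → ℝ} (hy : y ∉ Fin.tail '' K) : marginalOthers f y = 0 := by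
  have hzero (a : ℝ) : f (Matrix.vecCons a y) = 0 :=
    hf _ fun ha => hy ⟨_, ha, tail_vecCons a y⟩
  simp only [marginalOthers, hzero, integral_zero]

theorem integral_mul_comp_tail (hfg : Integrable fun x => f x * g (Fin.tail x)) :
    ∫ x, f x * g (Fin.tail x) = ∫ y, marginalOthers f y * g y := by
  have hfg' := (measurePreserving_vecCons.integrable_comp_emb measurableEmbedding_vecCons).2 hfg
  rw [← measurePreserving_vecCons.integral_comp measurableEmbedding_vecCons]
  refine (integral_prod_symm _ hfg').trans (integral_congr_ae (.of_forall fun y => ?_))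
  simp only [Function.comp_apply, tail_vecCons, integral_mul_const, marginalOthers]

theorem integrable_mul_comp_tail (hf0 : ∀ x, 0 ≤ f x) (hf : Integrable f)
    (hg : AEStronglyMeasurable g) (hfg : Integrable fun y => marginalOthers f y * g y) :
    Integrable fun x => f x * g (Fin.tail x) := by
  have hf' := (measurePreserving_vecCons.integrable_comp_emb measurableEmbedding_vecCons).2 hf
  rw [← measurePreserving_vecCons.integrable_comp_emb measurableEmbedding_vecCons]
  simp only [Function.comp_def, tail_vecCons]
  refine (integrable_prod_iff' (hf'.aestronglyMeasurable.mul hg.comp_snd)).2 ⟨?_, ?_⟩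
  · filter_upwards [hf'.prod_left_ae] with y hy using hy.mul_const (g y)
  · refine hfg.norm.congr (.of_forall fun y => ?_)
    simp only [norm_mul, Real.norm_of_nonneg (marginalOthers_nonneg hf0 y)]
    simp only [Pi.mul_apply, Function.comp_apply, norm_mul, integral_mul_const,
      Real.norm_of_nonneg (hf0 _), marginalOthers]

namespace IsContDiffFamily

variable {u : ℝ → (Fin (d + 1) → ℝ) → ℝ} {I : Set ℝ}

theorem exists_isCompact_marginalOthers {n : WithTop ℕ∞} (hu : IsContDiffFamily n I u) :
    ∃ K : Set (Fin d → ℝ), IsCompact K ∧ ∀ s ∈ I, ∀ y ∉ K, marginalOthers (u s) y = 0 :=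
  have ⟨_, hK, hKu⟩ := hu.exists_isCompact
  ⟨_, hK.image (contDiff_tail (n := 0)).continuous, fun s hs _ => marginalOthers_eq_zero (hKu s hs)⟩

theorem marginalOthers_zero (hu : IsContDiffFamily 0 I u) :
    IsContDiffFamily 0 I fun s => marginalOthers (u s) where
  contDiffOn := by
    obtain ⟨K, hK, hKu⟩ := hu.exists_isCompact
    refine contDiffOn_zero.2 (continuousOn_integral_of_compact_support
      (k := (fun x : Fin (d + 1) → ℝ => x 0) '' K) (hK.image (continuous_apply 0)) ?_
      fun z a hz ha => hKu z.1 hz.1 _ fun h => ha ⟨_, h, by simp⟩)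
    have hcons : Continuous fun w : (ℝ × (Fin d → ℝ)) × ℝ =>
        (w.1.1, (Matrix.vecCons w.2 w.1.2 : Fin (d + 1) → ℝ)) :=
      Continuous.prodMk (by fun_prop) ((contDiff_vecCons (n := 0)).continuous.comp
        (f := fun w : (ℝ × (Fin d → ℝ)) × ℝ => (w.2, w.1.2)) (by fun_prop))
    exact hu.contDiffOn.continuousOn.comp hcons.continuousOn fun w hw => ⟨hw.1.1, mem_univ _⟩
  exists_isCompact := hu.exists_isCompact_marginalOthers

theorem marginalOthers_of_isOpen {n : ℕ∞} (hu : IsContDiffFamily n I u) (hI : IsOpen I) :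
    IsContDiffFamily n I fun s => marginalOthers (u s) where
  contDiffOn := by
    obtain ⟨K, hK, hKu⟩ := hu.exists_isCompact
    have hcons : ContDiff ℝ n fun w : (ℝ × (Fin d → ℝ)) × ℝ =>
        (w.1.1, (Matrix.vecCons (-w.2) w.1.2 : Fin (d + 1) → ℝ)) :=
      ContDiff.prodMk (by fun_prop) (contDiff_vecCons.comp
        (f := fun w : (ℝ × (Fin d → ℝ)) × ℝ => (-w.2, w.1.2)) (by fun_prop))
    -- The marginal is the value at `0` of the convolution of `u s` with `1` in the first variable.
    simpa [convolution, marginalOthers] using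
      contDiffOn_convolution_right_with_param_comp (n := n) (𝕜 := ℝ) (μ := (volume : Measure ℝ))
        (ContinuousLinearMap.lsmul ℝ ℝ) (v := fun _ : ℝ × (Fin d → ℝ) => (0 : ℝ))
        (s := I ×ˢ (univ : Set (Fin d → ℝ))) contDiffOn_const (f := fun _ => (1 : ℝ))
        (g := fun z a => u z.1 (Matrix.vecCons (-a) z.2))
        (k := (fun x : Fin (d + 1) → ℝ => -x 0) '' K) (hI.prod isOpen_univ)
        (hK.image (by fun_prop)) (fun z a hz ha => hKu z.1 hz.1 _ fun h => ha ⟨_, h, by simp⟩)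
        (locallyIntegrable_const 1)
        (hu.contDiffOn.comp hcons.contDiffOn fun w hw => ⟨hw.1.1, mem_univ _⟩)
  exists_isCompact := hu.exists_isCompact_marginalOthers

end IsContDiffFamily

theorem fderiv_comp_tail {x : Fin (d + 1) → ℝ} (hg : DifferentiableAt ℝ g (Fin.tail x))
    (v : Fin (d + 1) → ℝ) :
    fderiv ℝ (fun x => g (Fin.tail x)) x v = fderiv ℝ g (Fin.tail x) (Fin.tail v) := by
  let L : (Fin (d + 1) → ℝ) →L[ℝ] (Fin d → ℝ) :=
    ContinuousLinearMap.pi fun i => ContinuousLinearMap.proj i.succ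
  have hderiv : HasFDerivAt (fun x => g (Fin.tail x)) ((fderiv ℝ g (Fin.tail x)).comp L) x :=
    HasFDerivAt.comp (f := L) x hg.hasFDerivAt L.hasFDerivAt
  exact DFunLike.congr_fun hderiv.fderiv v

theorem partialD_zero_comp_tail (hg : Differentiable ℝ g) :
    partialD 0 (fun x : Fin (d + 1) → ℝ => g (Fin.tail x)) = fun _ => 0 := by
  have htail : (Fin.tail (Pi.single 0 1 : Fin (d + 1) → ℝ) : Fin d → ℝ) = 0 := by
    funext i; simp [Fin.tail]
  funext x
  rw [partialD, fderiv_comp_tail (hg _), htail, map_zero]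

theorem partialD_succ_comp_tail (hg : Differentiable ℝ g) (i : Fin d) :
    partialD i.succ (fun x : Fin (d + 1) → ℝ => g (Fin.tail x)) =
      fun x => partialD i g (Fin.tail x) := by
  have htail : (Fin.tail (Pi.single i.succ 1 : Fin (d + 1) → ℝ) : Fin d → ℝ) = Pi.single i 1 := by
    funext j; simp [Fin.tail, Pi.single_apply]
  funext x
  rw [partialD, fderiv_comp_tail (hg _), htail, partialD]

variable {F : ℝ → (Fin (d + 1) → ℝ) → (Fin (d + 1) → ℝ)}
  {B : ℝ → (Fin (d + 1) → ℝ) → Matrix (Fin (d + 1)) (Fin m) ℝ}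
  {G : ℝ → (Fin d → ℝ) → (Fin d → ℝ)} {H : ℝ → (Fin d → ℝ) → Matrix (Fin d) (Fin m) ℝ}

theorem generator_comp_tail (hg : ContDiff ℝ 2 g) (s : ℝ) (x : Fin (d + 1) → ℝ) :
    generator F B s (fun x : Fin (d + 1) → ℝ => g (Fin.tail x)) x =
      generator (parameterDrift F (x 0)) (parameterNoise B (x 0)) s g (Fin.tail x) := by
  have hg' : Differentiable ℝ g := hg.differentiable two_ne_zero
  have hg'' (i) : Differentiable ℝ (partialD i g) :=
    (contDiff_partialD (m := 1) hg (by norm_num) i).differentiable one_ne_zero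
  have hx : (Matrix.vecCons (x 0) (Fin.tail x) : Fin (d + 1) → ℝ) = x := Fin.cons_self_tail x
  simp only [generator, Fin.sum_univ_succ, partialD_zero_comp_tail hg',
    partialD_succ_comp_tail hg', partialD_const, partialD_zero_comp_tail (hg'' _),
    partialD_succ_comp_tail (hg'' _), parameterDrift, parameterNoise, hx, Matrix.of_apply,
    mul_zero, zero_add, Finset.sum_const_zero]

protected theorem IsWeakFokkerPlanckSolution.marginalOthers {a b : ℝ}
    {u : ℝ → (Fin (d + 1) → ℝ) → ℝ}
    (hu : IsWeakFokkerPlanckSolution F B a b u) (huI : IsContDiffFamily 0 (Icc a b) u)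
    (hG : ∀ i, Continuous fun z : ℝ × (Fin d → ℝ) => G z.1 z.2 i)
    (hH : ∀ i l, Continuous fun z : ℝ × (Fin d → ℝ) => H z.1 z.2 i l)
    (hFG : ∀ c, parameterDrift F c = G) (hBH : ∀ c, parameterNoise B c = H) :
    IsWeakFokkerPlanckSolution G H a b fun s => marginalOthers (u s) := by
  intro φ hφ _ s hs
  have hφ2 : ContDiff ℝ 2 φ := hφ.of_le (by norm_cast)
  have htail : Continuous fun x : Fin (d + 1) → ℝ => (Fin.tail x : Fin d → ℝ) :=
    (contDiff_tail (n := 0)).continuous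
  have hfubini {τ} (hτ : τ ∈ Icc a b) {g : (Fin d → ℝ) → ℝ} (hg : Continuous g) :
      ∫ x, g (Fin.tail x) * u τ x = ∫ y, g y * marginalOthers (u τ) y := by
    simp only [mul_comm (g _)]
    exact integral_mul_comp_tail
      (((huI.contDiff hτ).continuous.mul (hg.comp htail)).integrable_of_hasCompactSupport
        (huI.hasCompactSupport hτ).mul_right)
  have hgen : Continuous fun z : ℝ × (Fin d → ℝ) => generator G H z.1 φ z.2 :=
    continuous_generator hG hH hφ2
  obtain ⟨K, hK, hKu⟩ := huI.exists_isCompact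
  have hweak := hu.integral_mul_eq_add hK hKu (hφ.comp contDiff_tail) hs
  simp only [Function.comp_def, generator_comp_tail hφ2, hFG, hBH] at hweak
  rw [hfubini hs hφ.continuous, hfubini ⟨le_rfl, hs.1.trans hs.2⟩ hφ.continuous] at hweak
  rw [hweak]
  congr 1
  refine intervalIntegral.integral_congr fun τ hτ => ?_
  rw [uIcc_of_le hs.1] at hτ
  exact hfubini ⟨hτ.1, hτ.2.trans hs.2⟩ (hgen.comp (Continuous.prodMk_right τ))

end Marginal

section Entropy

theorem le_add_deriv_mul_add_sq {f f' f'' : ℝ → ℝ} {S : Set ℝ} {M x y : ℝ} (hS : S.OrdConnected)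
    (hf : ∀ z ∈ S, HasDerivAt f (f' z) z) (hf' : ∀ z ∈ S, HasDerivAt f' (f'' z) z)
    (hM : ∀ z ∈ S, |f'' z| ≤ M) (hx : x ∈ S) (hy : y ∈ S) :
    f y ≤ f x + f' x * (y - x) + M * (y - x) ^ 2 := by
  have hsub : uIcc x y ⊆ S := hS.uIcc_subset hx hy
  have hM0 : 0 ≤ M := (abs_nonneg _).trans (hM x hx)
  have hlip : ∀ z ∈ uIcc x y, ‖f' z - f' x‖ ≤ M * ‖y - x‖ := fun z hz =>
    ((convex_uIcc x y).norm_image_sub_le_of_norm_hasDerivWithin_le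
      (fun w hw => (hf' w (hsub hw)).hasDerivWithinAt) (fun w hw => hM w (hsub hw))
      left_mem_uIcc hz).trans (mul_le_mul_of_nonneg_left (abs_sub_left_of_mem_uIcc hz) hM0)
  have hremainder := (convex_uIcc x y).norm_image_sub_le_of_norm_hasDerivWithin_le
    (f := fun z => f z - f' x * z)
    (fun w hw => ((hf w (hsub hw)).sub
      (by simpa using (hasDerivAt_id w).const_mul (f' x))).hasDerivWithinAt)
    hlip left_mem_uIcc right_mem_uIcc
  rw [mul_assoc, Real.norm_eq_abs (y - x), abs_mul_abs_self, ← sq] at hremainder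
  linarith [(le_abs_self _).trans hremainder]

theorem sq_deriv_le_of_nonneg {f f' f'' : ℝ → ℝ} {M x δ : ℝ}
    (hf : ∀ z ∈ Icc (x - δ) (x + δ), HasDerivAt f (f' z) z)
    (hf' : ∀ z ∈ Icc (x - δ) (x + δ), HasDerivAt f' (f'' z) z)
    (hM : ∀ z ∈ Icc (x - δ) (x + δ), |f'' z| ≤ M)
    (h0 : ∀ z ∈ Icc (x - δ) (x + δ), 0 ≤ f z) (hM0 : 0 < M) (hδ : |f' x| ≤ 2 * M * δ) :
    f' x ^ 2 ≤ 4 * M * f x := by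
  -- The quadratic upper bound for `f` around `x` is smallest at `x + h`.
  let h : ℝ := -(f' x / (2 * M))
  have hh : |h| ≤ δ := by
    rw [abs_neg, abs_div, abs_of_pos (by positivity : 0 < 2 * M), div_le_iff₀' (by positivity)]
    exact hδ
  have hx : x ∈ Icc (x - δ) (x + δ) := by
    constructor <;> linarith [(abs_nonneg h).trans hh]
  have hxh : x + h ∈ Icc (x - δ) (x + δ) := by
    constructor <;> linarith [abs_le.1 hh]
  have htaylor := (h0 _ hxh).trans (le_add_deriv_mul_add_sq ordConnected_Icc hf hf' hM hx hxh)
  have hvalue : f x + f' x * (x + h - x) + M * (x + h - x) ^ 2 =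
      (4 * M * f x - f' x ^ 2) / (4 * M) := by
    simp only [h]
    field_simp
    ring
  rw [hvalue, le_div_iff₀ (by positivity), zero_mul] at htaylor
  exact sub_nonneg.1 htaylor

theorem continuous_sqrt_mul_log : Continuous fun x : ℝ => √x * Real.log x := by
  have heq : (fun x : ℝ => √x * Real.log x) = fun x => 2 * (√x * Real.log √x) := by
    funext x
    rcases le_total 0 x with hx | hx
    · rw [Real.log_sqrt hx]; ring
    · simp [Real.sqrt_eq_zero_of_nonpos hx]
  rw [heq]
  exact (Real.continuous_mul_log.comp Real.continuous_sqrt).const_mul 2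

theorem hasDerivAt_mul_log_of_le_sq {f : ℝ → ℝ} {x M : ℝ} (hf : ContinuousAt f x)
    (h0 : ∀ᶠ y in 𝓝 x, 0 ≤ f y) (hM : ∀ᶠ y in 𝓝 x, f y ≤ M * (y - x) ^ 2) :
    HasDerivAt (fun y => f y * Real.log (f y)) 0 x := by
  have hfx : f x = 0 := le_antisymm (by simpa using hM.self_of_nhds) h0.self_of_nhds
  have hsqrt : (fun y => √(f y)) =O[𝓝 x] fun y => y - x := by
    refine .of_bound √(max M 0) ?_
    filter_upwards [hM] with y hy
    rw [Real.norm_of_nonneg (Real.sqrt_nonneg _), Real.norm_eq_abs, ← Real.sqrt_sq_eq_abs,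
      ← Real.sqrt_mul (le_max_right _ _)]
    exact Real.sqrt_le_sqrt (hy.trans (by gcongr; exact le_max_left _ _))
  have hlog : (fun y => √(f y) * Real.log (f y)) =o[𝓝 x] fun _ => (1 : ℝ) := by
    rw [Asymptotics.isLittleO_one_iff]
    simpa [ContinuousAt, hfx, Function.comp_def] using
      (continuous_sqrt_mul_log.continuousAt (x := f x)).comp hf
  rw [hasDerivAt_iff_isLittleO]
  refine (hsqrt.mul_isLittleO hlog).congr' ?_ (.of_forall fun y => mul_one _)
  filter_upwards [h0] with y hy
  simp [hfx, ← mul_assoc, Real.mul_self_sqrt hy]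

theorem hasDerivAt_mul_log_of_nonneg {f : ℝ → ℝ} {f' x M : ℝ} (hf : HasDerivAt f f' x)
    (h0 : ∀ᶠ y in 𝓝 x, 0 ≤ f y)
    (hM : ∀ᶠ y in 𝓝 x, f y ≤ f x + f' * (y - x) + M * (y - x) ^ 2) :
    HasDerivAt (fun y => f y * Real.log (f y)) ((Real.log (f x) + 1) * f') x := by
  by_cases hfx : f x = 0
  · have hmin : IsLocalMin f x := by simpa only [IsLocalMin, IsMinFilter, hfx] using h0
    have hf' : f' = 0 := hmin.hasDerivAt_eq_zero hf
    rw [hf', mul_zero]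
    exact hasDerivAt_mul_log_of_le_sq hf.continuousAt h0 (by simpa [hfx, hf'] using hM)
  · exact (Real.hasDerivAt_mul_log hfx).comp x hf

namespace IsContDiffFamily

variable {E : Type*} [NormedAddCommGroup E] [NormedSpace ℝ E] {v : ℝ → E → ℝ} {I : Set ℝ} {s : ℝ}

theorem hasDerivAt_mul_log (hv : IsContDiffFamily 2 I v) (hI : IsOpen I)
    (h0 : ∀ τ ∈ I, ∀ x, 0 ≤ v τ x) (hs : s ∈ I) (x : E) :
    HasDerivAt (fun τ => v τ x * Real.log (v τ x))
      ((Real.log (v s x) + 1) * timeDeriv v s x) s := by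
  have hv' : IsContDiffFamily 1 I (timeDeriv v) := hv.timeDeriv (by norm_num) hI
  have hv'' : IsContDiffFamily 0 I (timeDeriv (timeDeriv v)) := hv'.timeDeriv (by simp) hI
  have hIs := hI.mem_nhds hs
  obtain ⟨M, hM⟩ := hv''.eventually_abs_le hIs
  obtain ⟨ε, hε, hball⟩ := Metric.eventually_nhds_iff_ball.1 (hM.and hIs)
  refine hasDerivAt_mul_log_of_nonneg (f := fun τ => v τ x) (M := M)
    (hv.hasDerivAt two_ne_zero hI hs x) (Filter.eventually_of_mem hIs fun τ hτ => h0 τ hτ x) ?_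
  filter_upwards [Metric.ball_mem_nhds s hε] with τ hτ
  exact le_add_deriv_mul_add_sq (f := fun τ => v τ x) (convex_ball s ε).ordConnected
    (fun σ hσ => hv.hasDerivAt two_ne_zero hI (hball σ hσ).2 x)
    (fun σ hσ => hv'.hasDerivAt one_ne_zero hI (hball σ hσ).2 x)
    (fun σ hσ => (hball σ hσ).1 x) (Metric.mem_ball_self hε) hτ

theorem eventually_sq_timeDeriv_le (hv : IsContDiffFamily 2 I v) (hI : IsOpen I)
    (h0 : ∀ τ ∈ I, ∀ x, 0 ≤ v τ x) (hs : s ∈ I) :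
    ∃ N, 0 ≤ N ∧ ∀ᶠ τ in 𝓝 s, ∀ x, timeDeriv v τ x ^ 2 ≤ N * v τ x := by
  have hv' : IsContDiffFamily 1 I (timeDeriv v) := hv.timeDeriv (by norm_num) hI
  have hv'' : IsContDiffFamily 0 I (timeDeriv (timeDeriv v)) := hv'.timeDeriv (by simp) hI
  have hIs := hI.mem_nhds hs
  obtain ⟨C, hC⟩ := hv'.eventually_abs_le hIs
  obtain ⟨M, hM⟩ := hv''.eventually_abs_le hIs
  obtain ⟨ε, hε, hball⟩ := Metric.eventually_nhds_iff_ball.1 (hM.and (hC.and hIs))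
  let N : ℝ := max 1 (max M (C / ε))
  have hN : 0 < N := one_pos.trans_le (le_max_left _ _)
  have hMN : M ≤ N := (le_max_left _ _).trans (le_max_right _ _)
  have hCN : C ≤ 2 * N * (ε / 2) := by
    have hle : C / ε ≤ N := (le_max_right _ _).trans (le_max_right _ _)
    linarith [(div_le_iff₀ hε).1 hle]
  refine ⟨4 * N, by positivity, ?_⟩
  filter_upwards [Metric.ball_mem_nhds s (half_pos hε)] with τ hτ x
  have hsub {σ} (hσ : σ ∈ Icc (τ - ε / 2) (τ + ε / 2)) : σ ∈ Metric.ball s ε := by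
    rw [← Real.closedBall_eq_Icc, Metric.mem_closedBall] at hσ
    rw [Metric.mem_ball] at hτ ⊢
    linarith [dist_triangle σ τ s]
  have hτ' : τ ∈ Metric.ball s ε := Metric.ball_subset_ball (half_le_self hε.le) hτ
  exact sq_deriv_le_of_nonneg (f := fun σ => v σ x) (f' := fun σ => timeDeriv v σ x)
    (fun σ hσ => hv.hasDerivAt two_ne_zero hI (hball σ (hsub hσ)).2.2 x)
    (fun σ hσ => hv'.hasDerivAt one_ne_zero hI (hball σ (hsub hσ)).2.2 x)
    (fun σ hσ => ((hball σ (hsub hσ)).1 x).trans hMN)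
    (fun σ hσ => h0 σ (hball σ (hsub hσ)).2.2 x) hN (((hball τ hτ').2.1 x).trans hCN)

theorem eventually_abs_log_mul_timeDeriv_le (hv : IsContDiffFamily 2 I v) (hI : IsOpen I)
    (h0 : ∀ τ ∈ I, ∀ x, 0 ≤ v τ x) (hs : s ∈ I) :
    ∃ C, ∀ᶠ τ in 𝓝 s, ∀ x, |(Real.log (v τ x) + 1) * timeDeriv v τ x| ≤ C := by
  have hIs := hI.mem_nhds hs
  obtain ⟨N, hN, hsq⟩ := hv.eventually_sq_timeDeriv_le hI h0 hs
  obtain ⟨R, hR⟩ := hv.eventually_abs_le hIs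
  obtain ⟨D, hD⟩ := (hv.timeDeriv (m := 1) (by norm_num) hI).eventually_abs_le hIs
  obtain ⟨L, hL⟩ := (isCompact_Icc (a := -R) (b := R)).exists_bound_of_continuousOn
    continuous_sqrt_mul_log.continuousOn
  refine ⟨√N * L + D, ?_⟩
  filter_upwards [hsq, hR, hD] with τ hsqτ hRτ hDτ x
  have hsqrt : |timeDeriv v τ x| ≤ √N * √(v τ x) := by
    rw [← Real.sqrt_mul hN]
    exact Real.abs_le_sqrt (hsqτ x)
  have hlog : |Real.log (v τ x) * timeDeriv v τ x| ≤ √N * L :=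
    calc |Real.log (v τ x) * timeDeriv v τ x|
        ≤ |Real.log (v τ x)| * (√N * √(v τ x)) := by rw [abs_mul]; gcongr
      _ = √N * ‖√(v τ x) * Real.log (v τ x)‖ := by
        rw [norm_mul, Real.norm_of_nonneg (Real.sqrt_nonneg _), Real.norm_eq_abs]; ring
      _ ≤ √N * L := by gcongr; exact hL _ (abs_le.1 (hRτ x))
  rw [add_mul, one_mul]
  exact (abs_add_le _ _).trans (add_le_add hlog (hDτ x))

variable [MeasurableSpace E] [BorelSpace E] {μ : Measure E} [IsFiniteMeasureOnCompacts μ]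

theorem integrable_mul_log {n : WithTop ℕ∞} (hv : IsContDiffFamily n I v) (hs : s ∈ I) :
    Integrable (fun x => v s x * Real.log (v s x)) μ :=
  (Real.continuous_mul_log.comp (hv.contDiff hs).continuous).integrable_of_hasCompactSupport
    (hv.hasCompactSupport hs).mul_right

theorem hasDerivAt_integral_mul_log (hv : IsContDiffFamily 2 I v) (hI : IsOpen I)
    (h0 : ∀ τ ∈ I, ∀ x, 0 ≤ v τ x) (hs : s ∈ I) :
    HasDerivAt (fun τ => ∫ x, v τ x * Real.log (v τ x) ∂μ)
      (∫ x, (Real.log (v s x) + 1) * timeDeriv v s x ∂μ) s := by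
  have hv' : IsContDiffFamily 1 I (timeDeriv v) := hv.timeDeriv (by norm_num) hI
  have hIs := hI.mem_nhds hs
  obtain ⟨C, hC⟩ := hv.eventually_abs_log_mul_timeDeriv_le hI h0 hs
  obtain ⟨K, hK, hKv'⟩ := hv'.exists_isCompact
  have hmeas : Measurable fun x => (Real.log (v s x) + 1) * timeDeriv v s x :=
    ((hv.contDiff hs).continuous.measurable.log.add_const 1).mul
      (hv'.contDiff hs).continuous.measurable
  exact hasDerivAt_integral_of_eq_zero_of_notMem hK.measurableSet hK.measure_ne_top
    (f' := fun τ x => (Real.log (v τ x) + 1) * timeDeriv v τ x)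
    (Filter.eventually_of_mem hIs fun _ => hv.integrable_mul_log) hmeas.aestronglyMeasurable hC
    (Filter.eventually_of_mem hIs fun τ hτ x hx => by rw [hKv' τ hτ x hx, mul_zero])
    (Filter.eventually_of_mem hIs fun _ => hv.hasDerivAt_mul_log hI h0)

end IsContDiffFamily

end Entropy

section Frozen

variable {d m : ℕ}

theorem parameterDrift_frozenDrift (F : ℝ → (Fin (d + 1) → ℝ) → (Fin (d + 1) → ℝ)) (c : ℝ) :
    parameterDrift (frozenDrift F) c = parameterDrift F c := by
  funext s y i
  simp [parameterDrift, frozenDrift]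

theorem parameterNoise_frozenNoise
    (B : ℝ → (Fin (d + 1) → ℝ) → Matrix (Fin (d + 1)) (Fin m) ℝ) (c : ℝ) :
    parameterNoise (frozenNoise B) c = parameterNoise B c := by
  funext s y i l
  simp [parameterNoise, frozenNoise]

theorem contDiff_parameterDrift {n : WithTop ℕ∞}
    {F : ℝ → (Fin (d + 1) → ℝ) → (Fin (d + 1) → ℝ)}
    (hF : ∀ i, ContDiff ℝ n fun z : ℝ × (Fin (d + 1) → ℝ) => F z.1 z.2 i) (c : ℝ) (i : Fin d) :
    ContDiff ℝ n fun z : ℝ × (Fin d → ℝ) => parameterDrift F c z.1 z.2 i :=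
  (hF i.succ).comp
    (contDiff_fst.prodMk (contDiff_vecCons.comp (contDiff_const.prodMk contDiff_snd)))

theorem contDiff_parameterNoise {n : WithTop ℕ∞}
    {B : ℝ → (Fin (d + 1) → ℝ) → Matrix (Fin (d + 1)) (Fin m) ℝ}
    (hB : ∀ i l, ContDiff ℝ n fun z : ℝ × (Fin (d + 1) → ℝ) => B z.1 z.2 i l) (c : ℝ)
    (i : Fin d) (l : Fin m) :
    ContDiff ℝ n fun z : ℝ × (Fin d → ℝ) => parameterNoise B c z.1 z.2 i l :=
  (hB i.succ l).comp
    (contDiff_fst.prodMk (contDiff_vecCons.comp (contDiff_const.prodMk contDiff_snd)))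

theorem integrable_mul_log_marginalOthers {f : (Fin (d + 1) → ℝ) → ℝ} (hf : Continuous f)
    (hc : HasCompactSupport f) (h0 : ∀ x, 0 ≤ f x) :
    Integrable fun x => f x * Real.log (marginalOthers f (Fin.tail x)) := by
  have hconst : IsContDiffFamily 0 univ fun _ : ℝ => f :=
    ⟨(contDiff_zero.2 (hf.comp continuous_snd)).contDiffOn, tsupport f, hc.isCompact,
      fun _ _ _ => image_eq_zero_of_notMem_tsupport⟩
  have hmarginal := hconst.marginalOthers_zero
  refine integrable_mul_comp_tail h0 (hf.integrable_of_hasCompactSupport hc) ?_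
    (hmarginal.integrable_mul_log (mem_univ 0))
  exact (hmarginal.contDiff (mem_univ 0)).continuous.measurable.log.aestronglyMeasurable

variable {F : ℝ → (Fin (d + 1) → ℝ) → (Fin (d + 1) → ℝ)}
  {B : ℝ → (Fin (d + 1) → ℝ) → Matrix (Fin (d + 1)) (Fin m) ℝ}
  {G : ℝ → (Fin d → ℝ) → (Fin d → ℝ)} {H : ℝ → (Fin d → ℝ) → Matrix (Fin d) (Fin m) ℝ}
  {a b : ℝ}

theorem IsCompactPdf.isFokkerPlanckSolution {p : ℝ → (Fin d → ℝ) → ℝ}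
    (hp : IsCompactPdf.{u} G H a b p)
    (hG : ∀ i, ContDiff ℝ 1 fun z : ℝ × (Fin d → ℝ) => G z.1 z.2 i)
    (hH : ∀ i l, ContDiff ℝ 2 fun z : ℝ × (Fin d → ℝ) => H z.1 z.2 i l) :
    IsFokkerPlanckSolution G H a b p :=
  (hp.isWeakFokkerPlanckSolution (fun i => (hG i).continuous)
    fun i l => (hH i l).continuous).isFokkerPlanckSolution
    (hp.isContDiffFamily.of_le zero_le_two) (hp.isContDiffFamily.mono Ioo_subset_Icc_self) hG hH

theorem continuous_of_parameterDrift_eq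
    (hF₀ : Continuous fun z : ℝ × (Fin (d + 1) → ℝ) => F z.1 z.2 0)
    (hG : ∀ i, Continuous fun z : ℝ × (Fin d → ℝ) => G z.1 z.2 i)
    (hFG : ∀ c, parameterDrift F c = G) (i : Fin (d + 1)) :
    Continuous fun z : ℝ × (Fin (d + 1) → ℝ) => F z.1 z.2 i := by
  refine Fin.cases hF₀ (fun j => ?_) i
  have hFtail (s : ℝ) (x : Fin (d + 1) → ℝ) : F s x j.succ = G s (Fin.tail x) j := by
    rw [← hFG (x 0), parameterDrift, Matrix.vecCons, Fin.cons_self_tail]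
  simp only [hFtail]
  exact (hG j).comp (continuous_fst.prodMk
    ((contDiff_tail (n := 0)).continuous.comp continuous_snd))

theorem continuous_of_parameterNoise_eq
    (hB₀ : ∀ l, Continuous fun z : ℝ × (Fin (d + 1) → ℝ) => B z.1 z.2 0 l)
    (hH : ∀ i l, Continuous fun z : ℝ × (Fin d → ℝ) => H z.1 z.2 i l)
    (hBH : ∀ c, parameterNoise B c = H) (i : Fin (d + 1)) (l : Fin m) :
    Continuous fun z : ℝ × (Fin (d + 1) → ℝ) => B z.1 z.2 i l := by
  refine Fin.cases (hB₀ l) (fun j => ?_) i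
  have hBtail (s : ℝ) (x : Fin (d + 1) → ℝ) : B s x j.succ l = H s (Fin.tail x) j l := by
    rw [← hBH (x 0), parameterNoise, Matrix.of_apply, Matrix.vecCons, Fin.cons_self_tail]
  simp only [hBtail]
  exact (hH j l).comp (continuous_fst.prodMk
    ((contDiff_tail (n := 0)).continuous.comp continuous_snd))

theorem IsCompactPdf.isFokkerPlanckSolution_marginalOthers {p : ℝ → (Fin (d + 1) → ℝ) → ℝ}
    (hp : IsCompactPdf.{u} F B a b p)
    (hF₀ : Continuous fun z : ℝ × (Fin (d + 1) → ℝ) => F z.1 z.2 0)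
    (hB₀ : ∀ l, Continuous fun z : ℝ × (Fin (d + 1) → ℝ) => B z.1 z.2 0 l)
    (hG : ∀ i, ContDiff ℝ 1 fun z : ℝ × (Fin d → ℝ) => G z.1 z.2 i)
    (hH : ∀ i l, ContDiff ℝ 2 fun z : ℝ × (Fin d → ℝ) => H z.1 z.2 i l)
    (hFG : ∀ c, parameterDrift F c = G) (hBH : ∀ c, parameterNoise B c = H) :
    IsFokkerPlanckSolution G H a b fun s => marginalOthers (p s) := by
  have hGc (i) := (hG i).continuous
  have hHc (i l) := (hH i l).continuous
  have hp0 : IsContDiffFamily 0 (Icc a b) p := hp.isContDiffFamily.of_le zero_le_two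
  have hweak := hp.isWeakFokkerPlanckSolution (continuous_of_parameterDrift_eq hF₀ hGc hFG)
    (continuous_of_parameterNoise_eq hB₀ hHc hBH)
  exact (hweak.marginalOthers hp0 hGc hHc hFG hBH).isFokkerPlanckSolution hp0.marginalOthers_zero
    ((hp.isContDiffFamily.mono Ioo_subset_Icc_self).marginalOthers_of_isOpen (n := 2) isOpen_Ioo)
    hG hH

namespace IsFrozenEvolution

variable {t₀ t₁ t t₂ s : ℝ} {ρt : (Fin (d + 1) → ℝ) → ℝ} {ρ q : ℝ → (Fin (d + 1) → ℝ) → ℝ}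
  {r : ℝ → ℝ → (Fin d → ℝ) → ℝ}

theorem isFokkerPlanckSolution_marginalOthers (hqr : IsFrozenEvolution.{u} F B ρt t t₂ q r)
    (hG : ∀ i, ContDiff ℝ 1 fun z : ℝ × (Fin d → ℝ) => G z.1 z.2 i)
    (hH : ∀ i l, ContDiff ℝ 2 fun z : ℝ × (Fin d → ℝ) => H z.1 z.2 i l)
    (hFG : ∀ c, parameterDrift F c = G) (hBH : ∀ c, parameterNoise B c = H) :
    IsFokkerPlanckSolution G H t t₂ fun s => marginalOthers (q s) :=
  hqr.1.1.isFokkerPlanckSolution_marginalOthers (by simpa [frozenDrift] using continuous_const)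
    (by simpa [frozenNoise] using fun _ : Fin m => continuous_const) hG hH
    (fun c => (parameterDrift_frozenDrift F c).trans (hFG c))
    fun c => (parameterNoise_frozenNoise B c).trans (hBH c)

theorem parameter_eq_marginalOthers (hqr : IsFrozenEvolution.{u} F B ρt t t₂ q r)
    (hG : ∀ i, ContDiff ℝ 1 fun z : ℝ × (Fin d → ℝ) => G z.1 z.2 i)
    (hH : ∀ i l, ContDiff ℝ 2 fun z : ℝ × (Fin d → ℝ) => H z.1 z.2 i l)
    (hFG : ∀ c, parameterDrift F c = G) (hBH : ∀ c, parameterNoise B c = H)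
    (hs : s ∈ Icc t t₂) (c : ℝ) : r c s = marginalOthers (q s) := by
  obtain ⟨hr, hrt⟩ := hqr.2 c
  rw [hFG, hBH] at hr
  exact (hr.isFokkerPlanckSolution hG hH).eqOn
    (hqr.isFokkerPlanckSolution_marginalOthers hG hH hFG hBH) hG hH (by rw [hrt, hqr.1.2]) hs

theorem marginalOthers_eq (hqr : IsFrozenEvolution.{u} F B (ρ t) t t₂ q r)
    (hρ : IsFokkerPlanckSolution G H t₀ t₁ fun s => marginalOthers (ρ s)) (ht : t₀ ≤ t)
    (hG : ∀ i, ContDiff ℝ 1 fun z : ℝ × (Fin d → ℝ) => G z.1 z.2 i)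
    (hH : ∀ i l, ContDiff ℝ 2 fun z : ℝ × (Fin d → ℝ) => H z.1 z.2 i l)
    (hFG : ∀ c, parameterDrift F c = G) (hBH : ∀ c, parameterNoise B c = H)
    (hs : s ∈ Icc t (min t₁ t₂)) : marginalOthers (ρ s) = marginalOthers (q s) :=
  (hρ.mono ht (min_le_left _ _)).eqOn
    ((hqr.isFokkerPlanckSolution_marginalOthers hG hH hFG hBH).mono le_rfl (min_le_right _ _))
    hG hH (by simp only [hqr.1.2]) hs

theorem integrable_mul_log (hqr : IsFrozenEvolution.{u} F B ρt t t₂ q r) (hs : s ∈ Icc t t₂)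
    (hr : ∀ c, r c s = marginalOthers (q s)) :
    Integrable fun x : Fin (d + 1) → ℝ => q s x * Real.log (r (x 0) s (Fin.tail x)) := by
  have hq := hqr.1.1.isContDiffFamily
  simpa only [hr] using integrable_mul_log_marginalOthers (hq.contDiff hs).continuous
    (hq.hasCompactSupport hs) (hqr.1.1.2.1 s hs)

theorem entropyExcluded_eq (hqr : IsFrozenEvolution.{u} F B ρt t t₂ q r) (hs : s ∈ Icc t t₂)
    (hr : ∀ c, r c s = marginalOthers (q s)) : entropyExcluded q r s = entropyOthers q s := by
  have hint := hqr.integrable_mul_log hs hr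
  simp only [hr] at hint
  simp only [entropyExcluded, hr, entropyOthers]
  rw [integral_mul_comp_tail (g := fun y => Real.log (marginalOthers (q s) y)) hint]

end IsFrozenEvolution

end Frozen

theorem theorem2_general {d m : ℕ}
    (F : ℝ → (Fin (d + 1) → ℝ) → (Fin (d + 1) → ℝ))
    (B : ℝ → (Fin (d + 1) → ℝ) → Matrix (Fin (d + 1)) (Fin m) ℝ)
    (hF₀ : Continuous fun z : ℝ × (Fin (d + 1) → ℝ) => F z.1 z.2 0)
    (hB₀ : ∀ l, Continuous fun z : ℝ × (Fin (d + 1) → ℝ) => B z.1 z.2 0 l)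
    (G : ℝ → (Fin d → ℝ) → (Fin d → ℝ)) (H : ℝ → (Fin d → ℝ) → Matrix (Fin d) (Fin m) ℝ)
    (hG : ∀ i, ContDiff ℝ 1 fun z : ℝ × (Fin d → ℝ) => G z.1 z.2 i)
    (hH : ∀ i l, ContDiff ℝ 2 fun z : ℝ × (Fin d → ℝ) => H z.1 z.2 i l)
    (hFG : ∀ c, parameterDrift F c = G) (hBH : ∀ c, parameterNoise B c = H)
    (t₀ t₁ : ℝ) (ρ : ℝ → (Fin (d + 1) → ℝ) → ℝ) (hρ : IsCompactPdf.{u} F B t₀ t₁ ρ)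
    (t : ℝ) (ht : t ∈ Ioo t₀ t₁) (t₂ : ℝ) (ht₂ : t < t₂)
    (q : ℝ → (Fin (d + 1) → ℝ) → ℝ) (r : ℝ → ℝ → (Fin d → ℝ) → ℝ)
    (hqr : IsFrozenEvolution.{u} F B (ρ t) t t₂ q r) :
    IsInformationFlow ρ q r t 0 := by
  have hρ' := hρ.isFokkerPlanckSolution_marginalOthers hF₀ hB₀ hG hH hFG hBH
  have hr {s} (hs : s ∈ Icc t t₂) := hqr.parameter_eq_marginalOthers hG hH hFG hBH hs
  have hentropy {s} (hs : s ∈ Icc t (min t₁ t₂)) : entropyExcluded q r s = entropyOthers ρ s := by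
    have hs₂ : s ∈ Icc t t₂ := ⟨hs.1, hs.2.trans (min_le_right _ _)⟩
    rw [hqr.entropyExcluded_eq hs₂ (hr hs₂), entropyOthers, entropyOthers,
      hqr.marginalOthers_eq hρ' ht.1.le hG hH hFG hBH hs]
  have hmin : t < min t₁ t₂ := lt_min ht.2 ht₂
  have hderiv := (hρ'.isContDiffFamily_Ioo.hasDerivAt_integral_mul_log (μ := volume) isOpen_Ioo
    (fun s hs => marginalOthers_nonneg (hρ.2.1 s (Ioo_subset_Icc_self hs))) ht).neg
  refine ⟨?_, ?_, _, _, hderiv, ?_, (sub_self _).symm⟩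
  · filter_upwards [isOpen_Ioo.mem_nhds ht] with s hs
    exact hρ'.isContDiffFamily_Ioo.integrable_mul_log hs
  · filter_upwards [Icc_mem_nhdsGE ht₂] with s hs using hqr.integrable_mul_log hs (hr hs)
  · refine hderiv.hasDerivWithinAt.congr_of_eventuallyEq ?_ (hentropy ⟨le_rfl, hmin.le⟩)
    filter_upwards [Icc_mem_nhdsGE hmin] with s hs using hentropy hs

theorem theorem2 {d m : ℕ}
    (F : ℝ → (Fin (d + 1) → ℝ) → (Fin (d + 1) → ℝ))
    (B : ℝ → (Fin (d + 1) → ℝ) → Matrix (Fin (d + 1)) (Fin m) ℝ)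
    (hF : ∀ i, ContDiff ℝ 1 (fun z : ℝ × (Fin (d + 1) → ℝ) => F z.1 z.2 i))
    (hB : ∀ i l, ContDiff ℝ 2 (fun z : ℝ × (Fin (d + 1) → ℝ) => B z.1 z.2 i l))
    (t₀ t₁ : ℝ) (ρ : ℝ → (Fin (d + 1) → ℝ) → ℝ)
    (hρ : IsCompactPdf.{u} F B t₀ t₁ ρ)
    (hFind : ∀ (s a a' : ℝ) (y : Fin d → ℝ) (i : Fin d),
      F s (Matrix.vecCons a y) i.succ = F s (Matrix.vecCons a' y) i.succ)
    (hBind : ∀ (s a a' : ℝ) (y : Fin d → ℝ) (i : Fin d) (l : Fin m),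
      B s (Matrix.vecCons a y) i.succ l = B s (Matrix.vecCons a' y) i.succ l)
    (t : ℝ) (ht : t ∈ Ioo t₀ t₁) (t₂ : ℝ) (ht₂ : t < t₂)
    (q : ℝ → (Fin (d + 1) → ℝ) → ℝ) (r : ℝ → ℝ → (Fin d → ℝ) → ℝ)
    (hqr : IsFrozenEvolution.{u} F B (ρ t) t t₂ q r) :
    IsInformationFlow ρ q r t 0 :=
  theorem2_general F B (hF 0).continuous (fun l => (hB 0 l).continuous) _ _
    (contDiff_parameterDrift hF 0) (contDiff_parameterNoise hB 0)
    (fun c => funext fun s => funext fun y => funext fun i => hFind s c 0 y i)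
    (fun c => funext fun s => funext fun y => funext fun i => funext fun l => hBind s c 0 y i l)
    t₀ t₁ ρ hρ t ht t₂ ht₂ q r hqr
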